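/- **Model.** Base stations (BSs) form a homogeneous Poisson point process $\Phi_{BS}$ of intensity $\lambda_{BS}>0$ in $\mathbb{R}^2$; users have density $\lambda_{UE}>0$; the typical user is at the origin. Fix integers $N_{BS},N_{UE},U_M\ge 1$, reals $P,\lambda_c,D,\alpha_L,\alpha_N,\xi_L,\xi_N>0$, $p_{LOS}\in[0,1]$, and real sidelobe parameters $\rho_{BS},\rho_{UE}$. The link from a BS at $y$ is line-of-sight (L) with probability $p_{LOS}$ if $\|y\|\le D$, independently of everything else, and otherwise non-line-of-sight (N). Its path loss in dB is $\beta+10\alpha_j\log_{10}\|y\|+S_y$ with $\beta=20\log_{10}(4\pi/\lambda_c)$, $S_y\sim N(0,\xi_j^2)$, $j\in\{L,N\}$ the type of the link; $L(y,0)$ denotes the path loss in linear scale. The typical user is served by the BS $x$ of minimum path loss. For an array with $N$ antennas let $$q_{i}=\tfrac1\pi\Big(\arcsin\big(-1+\tfrac{2i+1}{N}\big)-\arcsin\big(-1+\tfrac{2i-1}{N}\big)\Big)\ (1\le i\le N-1),\qquad q_{N}=1-\sum_{i<N}q_{i},$$ written $q_{BS,i}$ for $N=N_{BS}$ and $q_{UE,i}$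 for $N=N_{UE}$. With $r=\lambda_{UE}/\lambda_{BS}$ let $$\kappa(n)=\frac{3.5^{3.5}}{n!}\frac{\Gamma(n+3.5)}{\Gamma(3.5)}r^n(3.5+r)^{-n-3.5}\quad(n\ge0),$$ and let $\tilde p(n)=\kappa(n)$ for $0\le n<U_M$, $\tilde p(U_M)=1-\sum_{i=0}^{U_M-1}\kappa(i)$. Put $G=PN_{BS}N_{UE}$, $a=\sum_{i=1}^{N_{UE}}q_{UE,i}^2$, $v_{n,k}=k+(n-k)\rho_{BS}^2$. The out-of-cell interference for single-path channels is $$I_0=\sum_{y\in\Phi_{BS},\,y\ne x}\frac{G|\gamma_y|^2\chi_y}{L(y,0)\,U_y}\in[0,\infty],$$ where terms with $U_y=0$ are $0$, the $\gamma_y$ are standard complex normal, $U_y$ has distribution $\tilde p$ and, given $U_y=n$, $\chi_y$ takes the value $v_{n,k}$ with probability $a\binom nk\sum_{j=1}^{N_{BS}}q_{BS,j}^{k+1}(1-q_{BS,j})^{n-k}$ and the value $\rho_{UE}^2v_{n,k}$ with probability $(1-a)\binom nk\sum_{j=1}^{N_{BS}}q_{BS,j}^{k+1}(1-q_{BS,j})^{n-k}$,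 $k=0,\dots,n$. The pairs $(U_y,\chi_y)$, the $\gamma_y$, the link types and the normalized shadowings are mutually independent, independent between BSs, and independent of the positions. With $m=-0.1\,\beta\ln10$, $\sigma_j=0.1\,\xi_j\ln10$, $\Upsilon_j(t)=(\ln(D^{\alpha_j}/t)-m)/\sigma_j$ and $Q$ the standard Gaussian tail function, let $M=M_L+M_N$, $$M_L(t)=\pi p_{LOS}\Big[D^2Q(\Upsilon_L(t))+t^{2/\alpha_L}e^{2\sigma_L^2/\alpha_L^2+2m/\alpha_L}\,Q\big(\tfrac{2\sigma_L}{\alpha_L}-\Upsilon_L(t)\big)\Big],$$ $$M_N(t)=-\pi p_{LOS}D^2Q(\Upsilon_N(t))+\pi t^{2/\alpha_N}e^{2\sigma_N^2/\alpha_N^2+2m/\alpha_N}\Big[1-p_{LOS}\,Q\big(\tfrac{2\sigma_N}{\alpha_N}-\Upsilon_N(t)\big)\Big].$$ **Lemma.** $M$ is differentiable on $(0,\infty)$ with $M'\ge0$. For every $s\ge0$ and almost every $l$ with respect to the law of $L(x,0)$ (which is carried by $(0,\infty)$), $$\mathbb{E}\big[e^{-sI_0}\,\big|\,L(x,0)=l\big]=\exp\Bigg(-\lambda_{BS}\sum_{n=0}^{U_M}\tilde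 p(n)\sum_{k=0}^n\binom nk\sum_{i=1}^{N_{BS}}q_{BS,i}^{k+1}(1-q_{BS,i})^{n-k}\Big\{a\int_l^\infty\frac{M'(t)\,dt}{1+\frac{tn}{sGv_{n,k}}}+(1-a)\int_l^\infty\frac{M'(t)\,dt}{1+\frac{tn}{sG\rho_{UE}^2v_{n,k}}}\Big\}\Bigg),$$ where an integrand is read as $0$ when the inner denominator ($sGv_{n,k}$, respectively $sG\rho_{UE}^2v_{n,k}$) is $0$ (in particular for $n=0$), and $e^{-\infty}=0$, $0\cdot\infty=0$. If $\alpha_N>2$, then $I_0<\infty$ almost surely and all the integrals with nonzero coefficient, hence the exponent, are finite for every $l>0$. -/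

import Mathlib

open MeasureTheory ProbabilityTheory
open scoped ENNReal NNReal

noncomputable section

namespace MmWave

/-- Parameters of the downlink millimetre-wave network. -/
structure Params where
  /-- density of base stations (BSs) -/
  lamBS : ℝ
  /-- density of users (UEs) -/
  lamUE : ℝ
  /-- number of BS antennas -/
  NBS : ℕ
  /-- number of UE antennas -/
  NUE : ℕ
  /-- maximum number of users served by a BS in one time slot -/
  UM : ℕ
  /-- transmit power -/
  power : ℝ
  /-- carrier wavelength -/
  wavelength : ℝ
  /-- line-of-sight (LOS) radius -/
  D : ℝ
  /-- probability that a link of length at most `D` is LOS -/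
  pLOS : unitInterval
  /-- LOS path loss exponent -/
  alphaL : ℝ
  /-- non-line-of-sight (NLOS) path loss exponent -/
  alphaN : ℝ
  /-- LOS shadowing standard deviation in dB -/
  xiL : ℝ
  /-- NLOS shadowing standard deviation in dB -/
  xiN : ℝ
  /-- inner product of two distinct BS beam steering vectors -/
  rhoBS : ℝ
  /-- inner product of two distinct UE beam steering vectors -/
  rhoUE : ℝ
  lamBS_pos : 0 < lamBS
  lamUE_pos : 0 < lamUE
  NBS_pos : 1 ≤ NBS
  NUE_pos : 1 ≤ NUE
  UM_pos : 1 ≤ UM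
  power_pos : 0 < power
  wavelength_pos : 0 < wavelength
  D_pos : 0 < D
  alphaL_pos : 0 < alphaL
  alphaN_pos : 0 < alphaN
  xiL_pos : 0 < xiL
  xiN_pos : 0 < xiN

/-- Probability that a quantized virtual angle takes its `i`-th value, `1 ≤ i ≤ N`, for an array
of `N` antennas. -/
def angleProb (N i : ℕ) : ℝ :=
  let q : ℕ → ℝ := fun i =>
    (Real.arcsin (-1 + (2 * i + 1) / N) - Real.arcsin (-1 + (2 * i - 1) / N)) / Real.pi
  if i < N then q i else 1 - ∑ j ∈ Finset.Ico 1 N, q j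

namespace Params

variable (p : Params)

/-- `G = P N_BS N_UE`. -/
def G : ℝ := p.power * p.NBS * p.NUE

/-- Reference path loss at one metre, in dB. -/
def beta : ℝ := 20 * Real.logb 10 (4 * Real.pi / p.wavelength)

/-! ### The load and the beam gain of an interfering BS -/

/-- Probability that `n` users are connected to an interfering BS. -/
def kappa (n : ℕ) : ℝ :=
  (3.5 : ℝ) ^ (3.5 : ℝ) / (n.factorial : ℝ) * (Real.Gamma (n + 3.5) / Real.Gamma 3.5)
    * (p.lamUE / p.lamBS) ^ n * (3.5 + p.lamUE / p.lamBS) ^ (-(n : ℝ) - 3.5)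

/-- Distribution of the number `min (UM, N)` of users scheduled by an interfering BS, where `N`
has probability mass function `kappa`. -/
def loadPMF (n : ℕ) : ℝ :=
  if n < p.UM then p.kappa n
  else if n = p.UM then 1 - ∑ i ∈ Finset.range p.UM, p.kappa i
  else 0

/-- Probability that two independent virtual angles at UEs coincide. -/
def alignProb : ℝ := ∑ i ∈ Finset.Icc 1 p.NUE, angleProb p.NUE i ^ 2

/-- Probability that exactly `k` of `n` independent BS virtual angles coincide with a further
independent one. -/
def collisionProb (n k : ℕ) : ℝ :=
  (n.choose k : ℝ) * ∑ i ∈ Finset.Icc 1 p.NBS,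
    angleProb p.NBS i ^ (k + 1) * (1 - angleProb p.NBS i) ^ (n - k)

/-- Beam gain `k + (n - k) ρ_BS²`. -/
def beamGain (n k : ℕ) : ℝ := k + ((n : ℝ) - k) * p.rhoBS ^ 2

/-- Joint law of `(U_y, χ_y)`: `U_y` has distribution `loadPMF` and, given `U_y = n`, `χ_y` is
`beamGain n k` with probability `alignProb * collisionProb n k` and `ρ_UE² * beamGain n k` with
probability `(1 - alignProb) * collisionProb n k`, for `k = 0, …, n`. -/
def loadGainLaw : Measure (ℕ × ℝ) :=
  ∑ n ∈ Finset.range (p.UM + 1), ∑ k ∈ Finset.range (n + 1),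
    (ENNReal.ofReal (p.loadPMF n * (p.alignProb * p.collisionProb n k)) •
        Measure.dirac (n, p.beamGain n k) +
      ENNReal.ofReal (p.loadPMF n * ((1 - p.alignProb) * p.collisionProb n k)) •
        Measure.dirac (n, p.rhoUE ^ 2 * p.beamGain n k))

end Params

/-! ### The network -/

/-- The plane with its Euclidean norm. -/
abbrev Plane : Type := EuclideanSpace ℝ (Fin 2)

/-- Number of indices `i` with `Y i ω ∈ A` (for measurable `A`). -/
def count {Ω E : Type*} [MeasurableSpace E] (Y : ℕ → Ω → E) (A : Set E) (ω : Ω) : ℝ≥0∞ :=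
  (Measure.sum fun i => Measure.dirac (Y i ω)) A

/-- The random points `Y 0, Y 1, …` form a Poisson point process with intensity measure `μ`. -/
structure IsPoissonProcess {Ω E : Type*} [MeasurableSpace Ω] [MeasurableSpace E]
    (Y : ℕ → Ω → E) (μ : Measure E) (P : Measure Ω) : Prop where
  law : ∀ A : Set E, MeasurableSet A → μ A < ∞ →
    P.map (count Y A) = (poissonMeasure (μ A).toNNReal).map (fun n : ℕ => (n : ℝ≥0∞))
  indep : ∀ (n : ℕ) (A : Fin n → Set E), (∀ j, MeasurableSet (A j)) →
    Pairwise (fun i j => Disjoint (A i) (A j)) → iIndepFun (fun j => count Y (A j)) P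

/-- Law of a complex normal variable with zero mean and unit variance. -/
def stdComplexNormal : Measure ℂ :=
  ((gaussianReal 0 (1 / 2)).prod (gaussianReal 0 (1 / 2))).map (fun z => (⟨z.1, z.2⟩ : ℂ))

/-- Random quantities attached to a BS. -/
structure Mark where
  /-- whether the link to the typical user is LOS if its length is at most `D` -/
  clear : Bool
  /-- shadowing in dB, divided by its standard deviation -/
  shadow : ℝ
  /-- small scale fading -/
  fading : ℂ
  /-- number of users scheduled, if the BS is an interferer -/
  load : ℕ
  /-- total beam gain towards the typical user, if the BS is an interferer -/
  gain : ℝ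

/-- A mark as a tuple. -/
def Mark.toTuple (m : Mark) : Bool × ℝ × ℂ × (ℕ × ℝ) :=
  (m.clear, m.shadow, m.fading, (m.load, m.gain))

instance : MeasurableSpace Mark := MeasurableSpace.comap Mark.toTuple inferInstance

namespace Params

variable (p : Params)

/-- Law of the tuple of marks of a BS: the LOS indicator, the shadowing, the fading and the pair
(load, gain) are independent. -/
def markLaw : Measure (Bool × ℝ × ℂ × (ℕ × ℝ)) :=
  (bernoulliMeasure true false p.pLOS).prod
    ((gaussianReal 0 1).prod (stdComplexNormal.prod p.loadGainLaw))

/-- Path loss in dB from a BS at `y` to the user at the origin: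
`β + 10 α log₁₀ ‖y‖ + S`, with `α` and the standard deviation of `S` depending on whether the link
is LOS or NLOS. -/
def lossDB (y : Plane) (m : Mark) : ℝ :=
  if ‖y‖ ≤ p.D ∧ m.clear = true then
    p.beta + 10 * p.alphaL * Real.logb 10 ‖y‖ + p.xiL * m.shadow
  else
    p.beta + 10 * p.alphaN * Real.logb 10 ‖y‖ + p.xiN * m.shadow

/-- Path loss in linear scale. -/
def loss (y : Plane) (m : Mark) : ℝ := (10 : ℝ) ^ (p.lossDB y m / 10)

end Params

/-- The network seen from the typical user at the origin, for single-path channels: a Poisson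
process of BSs with independent and identically distributed marks which are independent of the
positions, and the BS of minimum path loss, which serves the typical user. -/
structure Network {Ω : Type*} [MeasurableSpace Ω] (p : Params) (P : Measure Ω) where
  /-- position of a BS -/
  pos : ℕ → Ω → Plane
  /-- marks of a BS -/
  mark : ℕ → Ω → Mark
  /-- index of the serving BS -/
  serving : Ω → ℕ
  measurable_pos : ∀ i, Measurable (pos i)
  measurable_mark : ∀ i, Measurable (mark i)
  measurable_serving : Measurable serving
  isPoisson : IsPoissonProcess pos (ENNReal.ofReal p.lamBS • volume) P
  mark_law : ∀ i, P.map (fun ω => (mark i ω).toTuple) = p.markLaw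
  mark_indep : iIndepFun mark P
  mark_indep_pos : IndepFun (fun ω i => mark i ω) (fun ω i => pos i ω) P
  serving_min : ∀ᵐ ω ∂P, ∀ i,
    p.loss (pos (serving ω) ω) (mark (serving ω) ω) ≤ p.loss (pos i ω) (mark i ω)

/-- `exp (-x)` for `x ∈ [0, ∞]`, with `exp (-∞) = 0`. -/
def expNeg (x : ℝ≥0∞) : ℝ := if x = ∞ then 0 else Real.exp (-x.toReal)

namespace Network

variable {Ω : Type*} [MeasurableSpace Ω] {p : Params} {P : Measure Ω} (net : Network p P)

/-- Path loss between BS number `i` and the typical user. -/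
def lossOf (i : ℕ) (ω : Ω) : ℝ := p.loss (net.pos i ω) (net.mark i ω)

/-- Path loss of the serving link. -/
def servingLoss (ω : Ω) : ℝ := net.lossOf (net.serving ω) ω

/-- Out-of-cell interference power at the typical user,
`∑_{y ≠ x} G |γ_y|² L(y,0)⁻¹ χ_y / U_y`; a BS with `U_y = 0` contributes `0`. -/
def interference (ω : Ω) : ℝ≥0∞ :=
  ∑' i, if i = net.serving ω then 0 else
    ENNReal.ofReal (p.G * ‖(net.mark i ω).fading‖ ^ 2 * (net.lossOf i ω)⁻¹ *
      (net.mark i ω).gain / (net.mark i ω).load)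

/-- Laplace transform at `s` of the interference, conditioned on the path loss `l` of the serving
link: `E[exp (-s I) | L(x,0) = l]`. -/
def condLaplace [IsFiniteMeasure P] (s l : ℝ) : ℝ :=
  ∫ I, expNeg (ENNReal.ofReal s * I) ∂(condDistrib net.interference net.servingLoss P l)

end Network

/-! ### The closed form -/

/-- Complementary distribution function of the standard normal law. -/
def Q (x : ℝ) : ℝ := (gaussianReal 0 1).real (Set.Ioi x)

namespace Params

variable (p : Params)

/-- `m = -0.1 β ln 10`. -/
def m : ℝ := -0.1 * p.beta * Real.log 10

/-- `σ_L = 0.1 ξ_L ln 10`. -/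
def sigmaL : ℝ := 0.1 * p.xiL * Real.log 10

/-- `σ_N = 0.1 ξ_N ln 10`. -/
def sigmaN : ℝ := 0.1 * p.xiN * Real.log 10

/-- `Υ_L(t)`. -/
def upsL (t : ℝ) : ℝ := (Real.log (p.D ^ p.alphaL / t) - p.m) / p.sigmaL

/-- `Υ_N(t)`. -/
def upsN (t : ℝ) : ℝ := (Real.log (p.D ^ p.alphaN / t) - p.m) / p.sigmaN

/-- `M_L(t)`: for a unit density of BSs, the mean number of LOS links of loss less than `t`. -/
def ML (t : ℝ) : ℝ :=
  Real.pi * p.pLOS * (p.D ^ 2 * Q (p.upsL t) +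
    t ^ (2 / p.alphaL) * Real.exp (2 * p.sigmaL ^ 2 / p.alphaL ^ 2 + 2 * p.m / p.alphaL) *
      Q (2 * p.sigmaL ^ 2 / (p.alphaL * p.sigmaL) - p.upsL t))

/-- `M_N(t)`: for a unit density of BSs, the mean number of NLOS links of loss less than `t`. -/
def MN (t : ℝ) : ℝ :=
  -Real.pi * p.pLOS * p.D ^ 2 * Q (p.upsN t) +
    Real.pi * t ^ (2 / p.alphaN) *
      Real.exp (2 * p.sigmaN ^ 2 / p.alphaN ^ 2 + 2 * p.m / p.alphaN) *
      (1 - p.pLOS * Q (2 * p.sigmaN ^ 2 / (p.alphaN * p.sigmaN) - p.upsN t))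

/-- `M = M_L + M_N`. -/
def M (t : ℝ) : ℝ := p.ML t + p.MN t

/-- The fraction `1 / (1 + t n / (s G v))`, read as `0` if `s G v = 0`. -/
def kernel (s v : ℝ) (n : ℕ) (t : ℝ) : ℝ :=
  if s * p.G * v = 0 then 0 else 1 / (1 + t * n / (s * p.G * v))

/-- `∫_{t ≥ l} M'(t) dt / (1 + t n / (s G v))`, with values in `[0, ∞]`. -/
def lossIntegral (s l v : ℝ) (n : ℕ) : ℝ≥0∞ :=
  ∫⁻ t in Set.Ici l, ENNReal.ofReal (deriv p.M t * p.kernel s v n t)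

/-- The double sum over loads `n` and collision counts `k` in the exponent of the closed form. -/
def exponent (s l : ℝ) : ℝ≥0∞ :=
  ∑ n ∈ Finset.range (p.UM + 1), ENNReal.ofReal (p.loadPMF n) *
    ∑ k ∈ Finset.range (n + 1), ENNReal.ofReal (p.collisionProb n k) *
      (ENNReal.ofReal p.alignProb * p.lossIntegral s l (p.beamGain n k) n +
        ENNReal.ofReal (1 - p.alignProb) *
          p.lossIntegral s l (p.rhoUE ^ 2 * p.beamGain n k) n)

end Params

end MmWave

end

/-! Attach to every BS the pair (`L`, `f`) of its path loss and `s` times its interference power.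
Since the marks are i.i.d. and independent of the positions, these pairs form a Poisson process, and
the proof uses it only through its Laplace functional (`HasPoissonLaplace`). All exponentials take
values in `[0, ∞]` with `exp (-∞) = 0`. So infinite interference needs no separate case, and void
events are exponentials too.

Given that the smallest loss is `l`, the other points should be Poisson on `L > l`. This is proved
without Palm calculus. For `a ≤ b`, the event that no loss is below `a` is independent of the sum of
`f` over the points with `L > b`, because the two involve disjoint regions. This determines the
joint behaviour of the minimum and that sum on events placing the minimum below `b`. Taking `b` to
be the dyadic number just above the minimum and refining gives
`HasPoissonLaplace.setLIntegral_nexp_sum_ne_min`. The points strictly above the minimum are exactly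
the interferers because ties have probability zero: shadowing is Gaussian and has no atoms.

It remains to compute `∫ (1 - exp (-f))` over `L > l`. Averaging over Rayleigh fading turns `1 - exp
(-c |γ|²)` into `c / (1 + c)`, the kernel of the closed form. The mean number of links of loss at
most `t` is an average of areas of discs and annuli over a Gaussian shadowing; completing the square
identifies it with `M t` (`lossIntensity_Iic`). Hence `M` is monotone, and the loss intensity has
density `M'` on every `(l, ∞)` with `l > 0`.

For `αN > 2`, the kernel is at most a constant times `s / t`, and `M t` grows at most like `t ^ (2 /
αN)`. The exponent is therefore finite and `O(s)`, and letting `s → 0` in the Laplace transform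
gives finite interference almost surely. -/

namespace MmWave
open Filter Topology

/-! ### The function `exp (-x)` on `[0, ∞]` -/

/-- `exp (-x)` for `x ∈ [0, ∞]`, as an element of `[0, ∞]`. -/
noncomputable def nexp (x : ℝ≥0∞) : ℝ≥0∞ := EReal.exp (-(x : EReal))

@[simp] lemma nexp_zero : nexp 0 = 1 := by simp [nexp]

@[simp] lemma nexp_top : nexp ∞ = 0 := by simp [nexp]

lemma nexp_ofReal {x : ℝ} (hx : 0 ≤ x) :
    nexp (ENNReal.ofReal x) = ENNReal.ofReal (Real.exp (-x)) := by
  rw [nexp, EReal.coe_ennreal_ofReal, max_eq_left hx, ← EReal.coe_neg, EReal.exp_coe]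

lemma nexp_add (x y : ℝ≥0∞) : nexp (x + y) = nexp x * nexp y := by
  rw [nexp, EReal.coe_ennreal_add, EReal.neg_add (by simp) (by simp), sub_eq_add_neg,
    EReal.exp_add]; rfl

lemma nexp_sum {ι : Type*} (s : Finset ι) (f : ι → ℝ≥0∞) :
    nexp (∑ i ∈ s, f i) = ∏ i ∈ s, nexp (f i) := by
  classical
  induction s using Finset.induction_on with
  | empty => simp
  | insert a s ha ih => rw [Finset.sum_insert ha, Finset.prod_insert ha, nexp_add, ih]

lemma nexp_mul_natCast (x : ℝ≥0∞) (n : ℕ) : nexp (x * n) = nexp x ^ n := by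
  induction n with
  | zero => simp
  | succ n ih => rw [Nat.cast_succ, mul_add, mul_one, nexp_add, ih, pow_succ]

lemma continuous_nexp : Continuous nexp :=
  ENNReal.continuous_exp.comp (continuous_neg.comp continuous_coe_ennreal_ereal)

@[fun_prop] lemma measurable_nexp : Measurable nexp := continuous_nexp.measurable

lemma nexp_antitone : Antitone nexp := fun x y h => by
  apply EReal.exp_monotone
  exact EReal.neg_le_neg_iff.2 (by exact_mod_cast h)

lemma nexp_le_one (x : ℝ≥0∞) : nexp x ≤ 1 := by
  simpa using nexp_antitone (zero_le (a := x))

lemma nexp_ne_top (x : ℝ≥0∞) : nexp x ≠ ∞ := ((nexp_le_one x).trans_lt ENNReal.one_lt_top).ne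

lemma ofReal_expNeg (x : ℝ≥0∞) : ENNReal.ofReal (expNeg x) = nexp x := by
  induction x with
  | top => simp [expNeg]
  | coe x => rw [expNeg, if_neg (by simp), ← ENNReal.ofReal_coe_nnreal, nexp_ofReal (by simp)]; simp

lemma expNeg_nonneg (x : ℝ≥0∞) : 0 ≤ expNeg x := by
  unfold expNeg; split_ifs <;> positivity

lemma toReal_nexp (x : ℝ≥0∞) : (nexp x).toReal = expNeg x := by
  rw [← ofReal_expNeg, ENNReal.toReal_ofReal (expNeg_nonneg x)]

/-- The inverse of `nexp` on `[0, 1]`. -/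
noncomputable def nlog (g : ℝ≥0∞) : ℝ≥0∞ := (-ENNReal.log g).toENNReal

lemma nexp_nlog {g : ℝ≥0∞} (hg : g ≤ 1) : nexp (nlog g) = g := by
  have : 0 ≤ -ENNReal.log g := by
    rw [EReal.neg_nonneg]
    exact (ENNReal.log_monotone hg).trans (by simp)
  rw [nexp, nlog, EReal.coe_toENNReal this, neg_neg, ENNReal.exp_log]

@[fun_prop] lemma measurable_nlog : Measurable nlog :=
  EReal.continuous_toENNReal.measurable.comp
    (continuous_neg.measurable.comp ENNReal.continuous_log.measurable)

attribute [irreducible] nexp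

lemma tendsto_nexp_tsum (f : ℕ → ℝ≥0∞) :
    Tendsto (fun n => nexp (∑ i ∈ Finset.range n, f i)) atTop (𝓝 (nexp (∑' i, f i))) :=
  (continuous_nexp.tendsto _).comp ENNReal.summable.hasSum.tendsto_sum_nat

/-! ### The Laplace functional of a Poisson process -/

/-- This is the Poisson generating function at `z = exp (-a)`, summed as an exponential series. The
case `a = ∞`, `z = 0`, is the void probability. -/
lemma lintegral_nexp_poissonMeasure (r : ℝ≥0) (a : ℝ≥0∞) :
    ∫⁻ n : ℕ, nexp (a * n) ∂(poissonMeasure r) = nexp (r * (1 - nexp a)) := by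
  obtain ⟨b, hb0, hb⟩ : ∃ b : ℝ, 0 ≤ b ∧ nexp a = ENNReal.ofReal b :=
    ⟨expNeg a, expNeg_nonneg a, (ofReal_expNeg a).symm⟩
  have hb1 : b ≤ 1 := by
    have := nexp_le_one a
    rw [hb] at this
    exact (ENNReal.ofReal_le_one).1 this
  have h1 : (r : ℝ≥0∞) * (1 - nexp a) = ENNReal.ofReal (r * (1 - b)) := by
    rw [hb, ← ENNReal.ofReal_one, ← ENNReal.ofReal_sub _ hb0, ENNReal.ofReal_mul r.coe_nonneg,
      ENNReal.ofReal_coe_nnreal]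
  have hs : HasSum (fun n : ℕ => Real.exp (-r) * ((r * b) ^ n / n.factorial))
      (Real.exp (-r) * Real.exp (r * b)) := by
    have := NormedSpace.expSeries_div_hasSum_exp ((r : ℝ) * b)
    rw [← Real.exp_eq_exp_ℝ] at this
    exact this.mul_left _
  rw [h1, nexp_ofReal (mul_nonneg r.coe_nonneg (by linarith)), poissonMeasure, lintegral_sum_measure]
  simp_rw [lintegral_smul_measure, lintegral_dirac, nexp_mul_natCast, hb,
    ← ENNReal.ofReal_pow hb0, smul_eq_mul]
  rw [show Real.exp (-((r : ℝ) * (1 - b))) = Real.exp (-r) * Real.exp (r * b) by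
    rw [← Real.exp_add]; ring_nf, ← hs.tsum_eq, ENNReal.ofReal_tsum_of_nonneg _ hs.summable]
  · refine tsum_congr fun n => ?_
    rw [← ENNReal.ofReal_mul (by positivity)]
    congr 1
    rw [mul_pow]; ring
  · intro n; positivity

/-- The random points `X 0, X 1, …` have the Laplace functional of a Poisson process with
intensity measure `μ`. -/
def HasPoissonLaplace {Ω E : Type*} [MeasurableSpace Ω] [MeasurableSpace E]
    (X : ℕ → Ω → E) (μ : Measure E) (P : Measure Ω) : Prop :=
  ∀ h : E → ℝ≥0∞, Measurable h →
    ∫⁻ ω, nexp (∑' i, h (X i ω)) ∂P = nexp (∫⁻ y, (1 - nexp (h y)) ∂μ)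

section
variable {Ω E : Type*} [MeasurableSpace Ω] [MeasurableSpace E] {X : ℕ → Ω → E}
  {μ : Measure E} {P : Measure Ω}

lemma measurable_count (hX : ∀ i, Measurable (X i)) {A : Set E} (hA : MeasurableSet A) :
    Measurable (count X A) := by
  have : count X A = fun ω => ∑' i, (A.indicator 1 (X i ω) : ℝ≥0∞) := by
    ext ω
    simp only [count, Measure.sum_apply _ hA, Measure.dirac_apply' _ hA]
  rw [this]
  exact Measurable.tsum fun i => (measurable_one.indicator hA).comp (hX i)

lemma IsPoissonProcess.lintegral_nexp_count (hP : IsPoissonProcess X μ P)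
    (hX : ∀ i, Measurable (X i)) {A : Set E} (hA : MeasurableSet A) (hμ : μ A < ∞) (a : ℝ≥0∞) :
    ∫⁻ ω, nexp (a * count X A ω) ∂P = nexp (μ A * (1 - nexp a)) := by
  have h := hP.law A hA hμ
  rw [← lintegral_map (f := fun x => nexp (a * x)) (by fun_prop) (measurable_count hX hA), h,
    lintegral_map (by fun_prop) (by fun_prop), lintegral_nexp_poissonMeasure,
    ENNReal.coe_toNNReal hμ.ne]

/-- Grouping the points by the value of `f` expresses the sum through counts of the level sets.
These are disjoint, so the counts are independent and the expectation factorizes. -/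
lemma IsPoissonProcess.lintegral_nexp_simpleFunc (hP : IsPoissonProcess X μ P)
    (hX : ∀ i, Measurable (X i)) (f : SimpleFunc E ℝ≥0∞) (hf : ∀ x ≠ 0, μ (f ⁻¹' {x}) < ∞) :
    ∫⁻ ω, nexp (∑' i, f (X i ω)) ∂P = nexp (∫⁻ y, (1 - nexp (f y)) ∂μ) := by
  have hsum : ∀ ω, ∑' i, f (X i ω) = ∑ x ∈ f.range, x * count X (f ⁻¹' {x}) ω := by
    intro ω
    have : ∑' i, f (X i ω) = ∫⁻ y, f y ∂(Measure.sum fun i => Measure.dirac (X i ω)) := by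
      rw [lintegral_sum_measure]
      exact tsum_congr fun i => (lintegral_dirac' _ f.measurable).symm
    rw [this, SimpleFunc.lintegral_eq_lintegral]
    rfl
  have hint : ∫⁻ y, (1 - nexp (f y)) ∂μ = ∑ x ∈ f.range, (1 - nexp x) * μ (f ⁻¹' {x}) := by
    have : ∫⁻ y, (1 - nexp (f y)) ∂μ = ∫⁻ y, (f.map fun x => 1 - nexp x) y ∂μ := rfl
    rw [this, SimpleFunc.lintegral_eq_lintegral, SimpleFunc.map_lintegral]
  let e := f.range.equivFin
  let A : Fin f.range.card → Set E := fun j => f ⁻¹' {((e.symm j : f.range) : ℝ≥0∞)}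
  have hind : iIndepFun (fun j => count X (A j)) P := by
    refine hP.indep _ A (fun j => f.measurableSet_fiber _) fun i j hij => ?_
    refine Disjoint.preimage _ (Set.disjoint_singleton.2 fun h => hij ?_)
    exact e.symm.injective (Subtype.ext h)
  have key : ∀ g : ℝ≥0∞ → ℝ≥0∞, ∏ x ∈ f.range, g x = ∏ j, g (e.symm j : f.range) := by
    intro g
    rw [← Finset.prod_coe_sort f.range]
    exact (Equiv.prod_comp e.symm (fun x : f.range => g x)).symm
  simp_rw [hsum, hint, nexp_sum, key]
  rw [lintegral_prod_eq_prod_lintegral_of_indepFun (μ := P) (s := Finset.univ)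
    (X := fun j ω => nexp ((e.symm j : f.range) * count X (A j) ω))]
  · refine Finset.prod_congr rfl fun j _ => ?_
    by_cases h0 : ((e.symm j : f.range) : ℝ≥0∞) = 0
    -- The level set of the value `0` may have infinite mass, but its factor is `1` on both sides.
    · have := hind.isProbabilityMeasure
      simp [h0]
    · rw [hP.lintegral_nexp_count hX (f.measurableSet_fiber _) (hf _ h0), mul_comm]
  · exact hind.comp (fun j x => nexp ((e.symm j : f.range) * x)) fun j => by fun_prop
  · intro j
    exact measurable_nexp.comp ((measurable_count hX (f.measurableSet_fiber _)).const_mul _)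

/-- Approximate `h` from below by simple functions cut off to spanning sets of finite mass. The sums
and the intensity integrals converge monotonically inside the exponential, and the expectation
converges by domination by `1`. -/
lemma IsPoissonProcess.hasPoissonLaplace [SigmaFinite μ] [IsFiniteMeasure P]
    (hP : IsPoissonProcess X μ P)
    (hX : ∀ i, Measurable (X i)) : HasPoissonLaplace X μ P := by
  intro h hh
  let f : ℕ → SimpleFunc E ℝ≥0∞ := fun n =>
    (SimpleFunc.eapprox h n).restrict (spanningSets μ n)
  have hfm : ∀ y, Monotone fun n => f n y := by
    intro y n k hnk
    simp only [f, SimpleFunc.restrict_apply _ (measurableSet_spanningSets μ _)]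
    calc _ ≤ (spanningSets μ n).indicator (SimpleFunc.eapprox h k) y :=
          Set.indicator_le_indicator (SimpleFunc.monotone_eapprox h hnk y)
      _ ≤ _ := Set.indicator_le_indicator_of_subset (monotone_spanningSets μ hnk)
          (fun _ => zero_le) y
  have hft : ∀ y, Tendsto (fun n => f n y) atTop (𝓝 (h y)) := by
    intro y
    have h1 : Tendsto (fun n => SimpleFunc.eapprox h n y) atTop (𝓝 (h y)) :=
      SimpleFunc.tendsto_eapprox hh y
    refine h1.congr' ?_
    filter_upwards [eventually_ge_atTop (spanningSetsIndex μ y)] with n hn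
    simp only [f, SimpleFunc.restrict_apply _ (measurableSet_spanningSets μ _)]
    rw [Set.indicator_of_mem]
    exact monotone_spanningSets μ hn (mem_spanningSetsIndex μ y)
  have hfin : ∀ n, ∀ x ≠ 0, μ (f n ⁻¹' {x}) < ∞ := by
    intro n x hx
    refine lt_of_le_of_lt (measure_mono ?_) (measure_spanningSets_lt_top μ n)
    intro y hy
    by_contra hc
    apply hx
    rw [← Set.mem_singleton_iff.1 hy]
    simp only [f, SimpleFunc.restrict_apply _ (measurableSet_spanningSets μ _),
      Set.indicator_of_notMem hc]
  have hsum : ∀ ω, Tendsto (fun n => ∑' i, f n (X i ω)) atTop (𝓝 (∑' i, h (X i ω))) := by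
    intro ω
    simp_rw [← lintegral_count]
    exact lintegral_tendsto_of_tendsto_of_monotone (fun n => by fun_prop)
      (ae_of_all _ fun i => hfm _) (ae_of_all _ fun i => hft _)
  have hL : Tendsto (fun n => ∫⁻ ω, nexp (∑' i, f n (X i ω)) ∂P) atTop
      (𝓝 (∫⁻ ω, nexp (∑' i, h (X i ω)) ∂P)) := by
    refine tendsto_lintegral_of_dominated_convergence (fun _ => 1) (fun n => ?_)
      (fun n => ae_of_all _ fun ω => nexp_le_one _) (by simp) (ae_of_all _ fun ω => ?_)
    · exact measurable_nexp.comp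
        (Measurable.tsum fun i => (f n).measurable.comp (hX i))
    · exact (continuous_nexp.tendsto _).comp (hsum ω)
  have hR : Tendsto (fun n => nexp (∫⁻ y, (1 - nexp (f n y)) ∂μ)) atTop
      (𝓝 (nexp (∫⁻ y, (1 - nexp (h y)) ∂μ))) := by
    refine (continuous_nexp.tendsto _).comp ?_
    refine lintegral_tendsto_of_tendsto_of_monotone
      (fun n => (measurable_const.sub (measurable_nexp.comp (f n).measurable)).aemeasurable)
      (ae_of_all _ fun y n k hnk => tsub_le_tsub_left (nexp_antitone (hfm y hnk)) _)
      (ae_of_all _ fun y => ?_)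
    exact ENNReal.Tendsto.sub tendsto_const_nhds ((continuous_nexp.tendsto _).comp (hft y))
      (Or.inl ENNReal.one_ne_top)
  refine tendsto_nhds_unique hL (hR.congr fun n => ?_)
  exact (hP.lintegral_nexp_simpleFunc hX (f n) (hfin n)).symm

end

/-! ### Images and independent markings of a Poisson process -/

section
variable {Ω E F : Type*} [MeasurableSpace Ω] [MeasurableSpace E] [MeasurableSpace F]
  {P : Measure Ω}

lemma HasPoissonLaplace.map {X : ℕ → Ω → E} {μ : Measure E} (hX : HasPoissonLaplace X μ P)
    {φ : E → F} (hφ : Measurable φ) :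
    HasPoissonLaplace (fun i ω => φ (X i ω)) (μ.map φ) P := by
  intro h hh
  rw [hX (fun x => h (φ x)) (hh.comp hφ), lintegral_map (by fun_prop) hφ]

/-- Decoupling of two independent random variables in an expectation. -/
lemma lintegral_indepFun_eq_lintegral_lintegral [IsFiniteMeasure P] {X : Ω → E} {Y : Ω → F}
    (hX : Measurable X) (hY : Measurable Y) (hXY : IndepFun X Y P) {f : E → F → ℝ≥0∞}
    (hf : Measurable (Function.uncurry f)) :
    ∫⁻ ω, f (X ω) (Y ω) ∂P = ∫⁻ ω, ∫⁻ ω', f (X ω') (Y ω) ∂P ∂P := by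
  have h := (indepFun_iff_map_prod_eq_prod_map_map hX.aemeasurable hY.aemeasurable).1 hXY
  have h1 : ∫⁻ ω, f (X ω) (Y ω) ∂P =
      ∫⁻ z, Function.uncurry f z ∂(P.map fun ω => (X ω, Y ω)) := by
    rw [lintegral_map hf (hX.prodMk hY)]; rfl
  rw [h1, h, lintegral_prod_symm' _ hf,
    lintegral_map hf.lintegral_prod_left' hY]
  exact lintegral_congr fun ω => lintegral_map (hf.comp measurable_prodMk_right) hX

/-- Independent marking of a Poisson process gives a Poisson process. -/
lemma HasPoissonLaplace.prodMk [IsProbabilityMeasure P] {pos : ℕ → Ω → E} {mark : ℕ → Ω → F}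
    {μ : Measure E} {ν : Measure F} (h : HasPoissonLaplace pos μ P)
    (hpos : ∀ i, Measurable (pos i)) (hmark : ∀ i, Measurable (mark i))
    (hν : ∀ i, P.map (mark i) = ν) (hind : iIndepFun mark P)
    (hindpos : IndepFun (fun ω i => mark i ω) (fun ω i => pos i ω) P) :
    HasPoissonLaplace (fun i ω => (pos i ω, mark i ω)) (μ.prod ν) P := by
  intro f hf
  have hνP : IsProbabilityMeasure ν := by
    rw [← hν 0]; exact Measure.isProbabilityMeasure_map (hmark 0).aemeasurable
  -- `g y` is the factor of a point at `y` averaged over its mark. Its negative logarithm `nlog (g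
  -- y)` then serves as a test function for the positions alone.
  let g : E → ℝ≥0∞ := fun y => ∫⁻ m, nexp (f (y, m)) ∂ν
  have hg : Measurable g := (measurable_nexp.comp hf).lintegral_prod_right'
  have hg1 : ∀ y, g y ≤ 1 := fun y =>
    (lintegral_mono fun m => nexp_le_one (f (y, m))).trans (by simp)
  -- Independence is applied to finitely many points at a time, with the positions frozen; the limit
  -- in `n` is taken afterwards.
  have hfin : ∀ n, ∫⁻ ω, nexp (∑ i ∈ Finset.range n, f (pos i ω, mark i ω)) ∂P =
      ∫⁻ ω, nexp (∑ i ∈ Finset.range n, nlog (g (pos i ω))) ∂P := by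
    intro n
    let φ : (ℕ → F) → (ℕ → E) → ℝ≥0∞ := fun m y =>
      nexp (∑ i ∈ Finset.range n, f (y i, m i))
    have hφ : Measurable (Function.uncurry φ) := by
      refine measurable_nexp.comp (Finset.measurable_sum _ fun i _ => hf.comp ?_)
      exact ((measurable_pi_apply i).comp measurable_snd).prodMk
        ((measurable_pi_apply i).comp measurable_fst)
    refine (lintegral_indepFun_eq_lintegral_lintegral (f := φ) (measurable_pi_lambda _ hmark)
      (measurable_pi_lambda _ hpos) hindpos hφ).trans (lintegral_congr fun ω => ?_)
    simp only [φ, nexp_sum, nexp_nlog (hg1 _)]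
    have hy : ∀ i, Measurable fun m => nexp (f (pos i ω, m)) := fun i =>
      measurable_nexp.comp (hf.comp measurable_prodMk_left)
    rw [lintegral_prod_eq_prod_lintegral_of_indepFun (μ := P) _
      (fun i ω' => nexp (f (pos i ω, mark i ω')))]
    · refine Finset.prod_congr rfl fun i _ => ?_
      rw [← lintegral_map (hy i) (hmark i), hν i]
    · exact hind.comp (fun i m => nexp (f (pos i ω, m))) hy
    · exact fun i => (hy i).comp (hmark i)
  have hlim : ∀ u : ℕ → Ω → ℝ≥0∞, (∀ i, Measurable (u i)) →
      Tendsto (fun n => ∫⁻ ω, nexp (∑ i ∈ Finset.range n, u i ω) ∂P) atTop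
        (𝓝 (∫⁻ ω, nexp (∑' i, u i ω) ∂P)) := fun u hu =>
    tendsto_lintegral_of_dominated_convergence (fun _ => 1)
      (fun n => measurable_nexp.comp (Finset.measurable_sum _ fun i _ => hu i))
      (fun n => ae_of_all _ fun ω => nexp_le_one _) (by simp)
      (ae_of_all _ fun ω => tendsto_nexp_tsum _)
  have h1 := hlim (fun i ω => f (pos i ω, mark i ω)) fun i => hf.comp ((hpos i).prodMk (hmark i))
  have h2 := hlim (fun i ω => nlog (g (pos i ω))) fun i =>
    measurable_nlog.comp (hg.comp (hpos i))
  rw [tendsto_nhds_unique h1 (h2.congr fun n => (hfin n).symm),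
    h (fun y => nlog (g y)) (measurable_nlog.comp hg)]
  congr 1
  rw [lintegral_prod _ (by fun_prop)]
  refine lintegral_congr fun y => ?_
  rw [nexp_nlog (hg1 y), lintegral_sub (by fun_prop)
    ((hg1 y).trans_lt ENNReal.one_lt_top).ne (ae_of_all _ fun m => nexp_le_one _)]
  simp [g]

end

/-! ### The sum over the points other than the minimal one -/

/-- The smallest multiple of `2⁻ᵏ` which is greater than `l`. -/
noncomputable def dyadicAbove (k : ℕ) (l : ℝ) : ℝ := (⌊2 ^ k * l⌋ + 1) / 2 ^ k

lemma lt_dyadicAbove (k : ℕ) (l : ℝ) : l < dyadicAbove k l := by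
  rw [dyadicAbove, lt_div_iff₀ (by positivity), mul_comm]
  exact Int.lt_floor_add_one _

lemma dyadicAbove_le (k : ℕ) (l : ℝ) : dyadicAbove k l ≤ l + (1 / 2) ^ k := by
  rw [dyadicAbove, div_le_iff₀ (by positivity), add_mul, ← mul_pow]
  have := Int.floor_le (2 ^ k * l)
  norm_num
  linarith

lemma antitone_dyadicAbove (l : ℝ) : Antitone fun k => dyadicAbove k l := by
  refine antitone_nat_of_succ_le fun k => ?_
  -- Every multiple of `2⁻ᵏ` is also one of `2⁻ᵏ⁻¹`, so the finer grid has a point above `l` at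
  -- least as close.
  have h : ⌊(2 : ℝ) ^ (k + 1) * l⌋ < 2 * (⌊(2 : ℝ) ^ k * l⌋ + 1) := by
    rw [Int.floor_lt]
    push_cast
    have := Int.lt_floor_add_one ((2 : ℝ) ^ k * l)
    rw [pow_succ]; linarith
  have h' : ((⌊(2 : ℝ) ^ (k + 1) * l⌋ + 1 : ℤ) : ℝ) ≤ ((2 * (⌊(2 : ℝ) ^ k * l⌋ + 1) : ℤ) : ℝ) := by
    exact_mod_cast h
  push_cast at h'
  rw [dyadicAbove, dyadicAbove, div_le_div_iff₀ (by positivity) (by positivity), pow_succ (2 : ℝ) k,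
    ← pow_succ (2 : ℝ) k]
  have := mul_le_mul_of_nonneg_right h' (pow_pos (two_pos (α := ℝ)) k).le
  rw [pow_succ (2 : ℝ) k] at this ⊢
  linarith

lemma tendsto_dyadicAbove (l : ℝ) : Tendsto (fun k => dyadicAbove k l) atTop (𝓝 l) := by
  refine tendsto_of_tendsto_of_tendsto_of_le_of_le tendsto_const_nhds ?_
    (fun k => (lt_dyadicAbove k l).le) fun k => dyadicAbove_le k l
  simpa using tendsto_const_nhds.add
    (tendsto_pow_atTop_nhds_zero_of_lt_one (r := (1 / 2 : ℝ)) (by norm_num) (by norm_num))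

lemma measurable_dyadicAbove (k : ℕ) : Measurable (dyadicAbove k) := by
  unfold dyadicAbove
  have : Measurable fun l : ℝ => ((⌊2 ^ k * l⌋ : ℤ) : ℝ) :=
    (measurable_from_top (f := fun z : ℤ => (z : ℝ))).comp
      (Int.measurable_floor.comp (measurable_const_mul _))
  fun_prop

/-- The thresholds decrease to `l` while staying above it, so the open half-lines increase to `Ioi
l`. Continuity along increasing unions holds for infinite measures as well. -/
lemma tendsto_measure_Ioi_dyadicAbove (ρ : Measure ℝ) (l : ℝ) :
    Tendsto (fun k => ρ (Set.Ioi (dyadicAbove k l))) atTop (𝓝 (ρ (Set.Ioi l))) := by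
  have hU : ⋃ k, Set.Ioi (dyadicAbove k l) = Set.Ioi l := by
    ext x
    simp only [Set.mem_iUnion, Set.mem_Ioi]
    refine ⟨fun ⟨k, hk⟩ => (lt_dyadicAbove k l).trans hk, fun hx => ?_⟩
    exact ((tendsto_dyadicAbove l).eventually_lt_const hx).exists
  rw [← hU]
  exact tendsto_measure_iUnion_atTop fun i j hij =>
    Set.Ioi_subset_Ioi (antitone_dyadicAbove l hij)

/-- Sum of the second components of the points whose first component exceeds `b`. -/
noncomputable def sumAbove {Ω : Type*} (W : ℕ → Ω → ℝ × ℝ≥0∞) (b : ℝ) (ω : Ω) : ℝ≥0∞ :=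
  ∑' i, if b < (W i ω).1 then (W i ω).2 else 0

/-- For fixed `ω` the sum is the mass of a half-line under the weighted point measure `∑ fᵢ δ_{Lᵢ}`.
-/
lemma tendsto_sumAbove_dyadicAbove {Ω : Type*} (W : ℕ → Ω → ℝ × ℝ≥0∞) (l : ℝ) (ω : Ω) :
    Tendsto (fun k => sumAbove W (dyadicAbove k l) ω) atTop (𝓝 (sumAbove W l ω)) := by
  have : ∀ b, sumAbove W b ω =
      (Measure.sum fun i => (W i ω).2 • Measure.dirac (W i ω).1) (Set.Ioi b) := by
    intro b
    rw [Measure.sum_apply _ measurableSet_Ioi]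
    refine tsum_congr fun i => ?_
    simp [Measure.dirac_apply' _ measurableSet_Ioi, Set.indicator_apply]
  simp_rw [this]
  exact tendsto_measure_Ioi_dyadicAbove _ l

section
variable {Ω : Type*} [MeasurableSpace Ω] {P : Measure Ω} {W : ℕ → Ω → ℝ × ℝ≥0∞}
  {κ : Measure (ℝ × ℝ≥0∞)} {S : Ω → ℕ}

/-- Laplace transform of `sumAbove` for a Poisson process with intensity measure `κ`. -/
noncomputable def laplaceAbove (κ : Measure (ℝ × ℝ≥0∞)) (b : ℝ) : ℝ≥0∞ :=
  nexp (∫⁻ w in {w | b < w.1}, (1 - nexp w.2) ∂κ)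

lemma tendsto_laplaceAbove_dyadicAbove (κ : Measure (ℝ × ℝ≥0∞)) (l : ℝ) :
    Tendsto (fun k => laplaceAbove κ (dyadicAbove k l)) atTop (𝓝 (laplaceAbove κ l)) := by
  have : ∀ b, laplaceAbove κ b =
      nexp (((κ.withDensity fun w => 1 - nexp w.2).map Prod.fst) (Set.Ioi b)) := by
    intro b
    rw [Measure.map_apply measurable_fst measurableSet_Ioi,
      withDensity_apply _ (measurable_fst measurableSet_Ioi)]
    rfl
  simp_rw [this]
  exact (continuous_nexp.tendsto _).comp (tendsto_measure_Ioi_dyadicAbove _ l)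

lemma measurable_sumAbove (hW : ∀ i, Measurable (W i)) {b : Ω → ℝ} (hb : Measurable b) :
    Measurable fun ω => sumAbove W (b ω) ω :=
  Measurable.tsum fun i => Measurable.ite (measurableSet_lt hb (hW i).fst) (hW i).snd
    measurable_const

lemma measurable_laplaceAbove (κ : Measure (ℝ × ℝ≥0∞)) : Measurable (laplaceAbove κ) := by
  refine Monotone.measurable fun a b hab => ?_
  exact nexp_antitone (lintegral_mono_set fun w hw => lt_of_le_of_lt hab hw)

lemma HasPoissonLaplace.lintegral_nexp_sumAbove (hκ : HasPoissonLaplace W κ P) (b : ℝ) :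
    ∫⁻ ω, nexp (sumAbove W b ω) ∂P = laplaceAbove κ b := by
  have hs : MeasurableSet {w : ℝ × ℝ≥0∞ | b < w.1} := measurableSet_lt (by fun_prop) (by fun_prop)
  have := hκ (fun w => if b < w.1 then w.2 else 0)
    (Measurable.ite hs measurable_snd measurable_const)
  refine this.trans ?_
  rw [laplaceAbove, ← lintegral_indicator hs]
  congr 1
  refine lintegral_congr fun w => ?_
  by_cases h : b < w.1 <;> simp [h]

/-- The indicator that the minimum is at least `a` equals `nexp (∑ h₁)`, where `h₁ = ∞` below `a`
and `0` elsewhere. Since `a ≤ b`, the supports of `h₁` and `h₂` are disjoint, so `1 - nexp (h₁ +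
h₂)` splits as a sum and the Laplace functional as a product. -/
lemma setLIntegral_le_min_nexp_sumAbove (hκ : HasPoissonLaplace W κ P)
    (hS : Measurable fun ω => (W (S ω) ω).1)
    (hmin : ∀ᵐ ω ∂P, ∀ i, (W (S ω) ω).1 ≤ (W i ω).1) {a b : ℝ} (hab : a ≤ b) :
    ∫⁻ ω in {ω | a ≤ (W (S ω) ω).1}, nexp (sumAbove W b ω) ∂P =
      P {ω | a ≤ (W (S ω) ω).1} * laplaceAbove κ b := by
  let h₁ : ℝ × ℝ≥0∞ → ℝ≥0∞ := fun w => if w.1 < a then ∞ else 0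
  let h₂ : ℝ × ℝ≥0∞ → ℝ≥0∞ := fun w => if b < w.1 then w.2 else 0
  have hm₁ : Measurable h₁ := Measurable.ite (measurableSet_lt (by fun_prop) (by fun_prop))
    measurable_const measurable_const
  have hm₂ : Measurable h₂ := Measurable.ite (measurableSet_lt (by fun_prop) (by fun_prop))
    measurable_snd measurable_const
  have hA : MeasurableSet {ω | a ≤ (W (S ω) ω).1} := measurableSet_le measurable_const hS
  have hind : ∀ᵐ ω ∂P, nexp (∑' i, h₁ (W i ω)) =
      Set.indicator {ω | a ≤ (W (S ω) ω).1} 1 ω := by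
    filter_upwards [hmin] with ω hω
    by_cases h : a ≤ (W (S ω) ω).1
    · have : ∀ i, h₁ (W i ω) = 0 := fun i => if_neg (not_lt.2 (h.trans (hω i)))
      simp [this, h]
    · have h0 : h₁ (W (S ω) ω) = ∞ := if_pos (not_le.1 h)
      have : ∑' i, h₁ (W i ω) = ∞ := top_le_iff.1 (h0 ▸ ENNReal.le_tsum (S ω))
      simp [this, h]
  have e1 : ∫⁻ ω, nexp (∑' i, (h₁ + h₂) (W i ω)) ∂P =
      ∫⁻ ω in {ω | a ≤ (W (S ω) ω).1}, nexp (sumAbove W b ω) ∂P := by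
    rw [← lintegral_indicator hA]
    refine lintegral_congr_ae ?_
    filter_upwards [hind] with ω hω
    simp only [Pi.add_apply]
    rw [ENNReal.tsum_add, nexp_add, hω]
    by_cases h : a ≤ (W (S ω) ω).1 <;> simp [h, h₂, sumAbove]
  have e2 : ∫⁻ ω, nexp (∑' i, h₁ (W i ω)) ∂P = P {ω | a ≤ (W (S ω) ω).1} := by
    rw [lintegral_congr_ae hind, lintegral_indicator_one hA]
  rw [← e1, ← e2, ← hκ.lintegral_nexp_sumAbove b, hκ _ (hm₁.add hm₂), hκ _ hm₁]
  have e3 : ∫⁻ ω, nexp (sumAbove W b ω) ∂P = _ := hκ _ hm₂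
  rw [e3, ← nexp_add, ← lintegral_add_left (by fun_prop)]
  congr 1
  refine lintegral_congr fun w => ?_
  by_cases h : w.1 < a
  · have : ¬ b < w.1 := by linarith
    simp [h₁, h₂, h, this]
  · simp [h₁, h]

/-- Both sides are finite measures in `C`, so agreement on the half-lines `[a, ∞)` suffices. The
previous lemma covers only `a ≤ b`, so the minimum is truncated at `b`: half-lines with `a > b`
become null, and sets below `b` are unaffected. -/
lemma setLIntegral_min_mem_nexp_sumAbove [IsProbabilityMeasure P] (hκ : HasPoissonLaplace W κ P)
    (hS : Measurable fun ω => (W (S ω) ω).1)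
    (hmin : ∀ᵐ ω ∂P, ∀ i, (W (S ω) ω).1 ≤ (W i ω).1) {b : ℝ} {C : Set ℝ}
    (hC : MeasurableSet C) (hCb : C ⊆ Set.Iio b) :
    ∫⁻ ω in {ω | (W (S ω) ω).1 ∈ C}, nexp (sumAbove W b ω) ∂P =
      P {ω | (W (S ω) ω).1 ∈ C} * laplaceAbove κ b := by
  let T : Ω → ℝ := fun ω => min b (W (S ω) ω).1
  have hT : Measurable T := measurable_const.min hS
  let ν₁ : Measure ℝ := (P.withDensity fun ω => nexp (sumAbove W b ω)).map T
  let ν₂ : Measure ℝ := laplaceAbove κ b • P.map T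
  have hf : IsFiniteMeasure (P.withDensity fun ω => nexp (sumAbove W b ω)) :=
    isFiniteMeasure_withDensity (by
      rw [hκ.lintegral_nexp_sumAbove b]; exact nexp_ne_top _)
  have hν : ν₁ = ν₂ := by
    refine Measure.ext_of_Ici _ _ fun a => ?_
    have hTa : MeasurableSet (T ⁻¹' Set.Ici a) := hT measurableSet_Ici
    simp only [ν₁, ν₂, Measure.map_apply hT measurableSet_Ici, Measure.smul_apply, smul_eq_mul,
      withDensity_apply _ hTa]
    rcases le_or_gt a b with hab | hab
    · have : T ⁻¹' Set.Ici a = {ω | a ≤ (W (S ω) ω).1} := by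
        ext ω; simp [T, hab]
      rw [this, setLIntegral_le_min_nexp_sumAbove hκ hS hmin hab, mul_comm]
    · have : T ⁻¹' Set.Ici a = ∅ := by
        ext ω
        simp only [T, Set.mem_preimage, Set.mem_Ici, le_min_iff, Set.mem_empty_iff_false, iff_false]
        exact fun h => absurd h.1 (not_le.2 hab)
      simp [this]
  have hTC : T ⁻¹' C = {ω | (W (S ω) ω).1 ∈ C} := by
    ext ω
    simp only [T, Set.mem_preimage, Set.mem_ofPred_eq]
    rcases le_or_gt b (W (S ω) ω).1 with h | h
    · rw [min_eq_left h]
      exact ⟨fun hb => absurd (hCb hb) (lt_irrefl b), fun hb => absurd (hCb hb) (not_lt.2 h)⟩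
    · rw [min_eq_right h.le]
  have := congrArg (fun ν => ν C) hν
  simp only [ν₁, ν₂, Measure.map_apply hT hC, Measure.smul_apply, smul_eq_mul,
    withDensity_apply _ (hT hC)] at this
  rw [hTC] at this
  rw [this, mul_comm]

/-- On each cell `⌊2 ^ k * l⌋ = z` the random threshold is a constant lying strictly above the cell,
so the fixed-threshold identity applies; the countably many cells are then summed. -/
lemma setLIntegral_min_mem_nexp_sumAbove_dyadicAbove [IsProbabilityMeasure P]
    (hκ : HasPoissonLaplace W κ P)
    (hS : Measurable fun ω => (W (S ω) ω).1)
    (hmin : ∀ᵐ ω ∂P, ∀ i, (W (S ω) ω).1 ≤ (W i ω).1) (k : ℕ) {B : Set ℝ}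
    (hB : MeasurableSet B) :
    ∫⁻ ω in {ω | (W (S ω) ω).1 ∈ B}, nexp (sumAbove W (dyadicAbove k (W (S ω) ω).1) ω) ∂P =
      ∫⁻ l in B, laplaceAbove κ (dyadicAbove k l) ∂(P.map fun ω => (W (S ω) ω).1) := by
  let C : ℤ → Set ℝ := fun z => B ∩ {l | ⌊2 ^ k * l⌋ = z}
  have hfl : Measurable fun l : ℝ => ⌊2 ^ k * l⌋ :=
    Int.measurable_floor.comp (measurable_const_mul _)
  have hC : ∀ z, MeasurableSet (C z) := fun z => hB.inter (hfl (measurableSet_singleton z))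
  have hd : Pairwise (Function.onFun Disjoint C) := by
    intro z z' hz
    refine Set.disjoint_left.2 fun l hl hl' => hz ?_
    exact hl.2.symm.trans hl'.2
  have hBU : B = ⋃ z, C z := by
    ext l; simp [C]
  have hU : {ω | (W (S ω) ω).1 ∈ B} = ⋃ z, {ω | (W (S ω) ω).1 ∈ C z} := by
    ext ω; simp [C]
  rw [hU, lintegral_iUnion (s := fun z => {ω | (W (S ω) ω).1 ∈ C z}) (fun z => hS (hC z))
    (fun z z' hz => Disjoint.preimage _ (hd hz))]
  conv_rhs => rw [hBU, lintegral_iUnion hC hd]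
  refine tsum_congr fun z => ?_
  have hdy : ∀ l ∈ C z, dyadicAbove k l = (z + 1) / 2 ^ k := by
    rintro l ⟨-, hl⟩
    rw [dyadicAbove, hl]
  have hSC : MeasurableSet {ω | (W (S ω) ω).1 ∈ C z} := hS (hC z)
  rw [setLIntegral_congr_fun (g := fun ω => nexp (sumAbove W ((z + 1) / 2 ^ k) ω)) hSC
    (fun ω hω => by
      simp only [hdy _ hω]),
    setLIntegral_min_mem_nexp_sumAbove hκ hS hmin (hC z)
      (fun l hl => by rw [← hdy l hl]; exact lt_dyadicAbove k l),
    setLIntegral_congr_fun (g := fun _ => laplaceAbove κ ((z + 1) / 2 ^ k)) (hC z)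
      (fun l hl => by simp only [hdy _ hl]),
    setLIntegral_const, Measure.map_apply hS (hC z), mul_comm]
  rfl

/-- For a Poisson process of points `(L, f)` whose smallest `L` is attained exactly once, the
Laplace transform of the sum of the `f` over all other points, given the smallest `L`. -/
theorem HasPoissonLaplace.setLIntegral_nexp_sum_ne_min [IsProbabilityMeasure P]
    (hκ : HasPoissonLaplace W κ P)
    (hW : ∀ i, Measurable (W i)) (hS : Measurable fun ω => (W (S ω) ω).1)
    (hmin : ∀ᵐ ω ∂P, ∀ i, i ≠ S ω → (W (S ω) ω).1 < (W i ω).1) {B : Set ℝ}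
    (hB : MeasurableSet B) :
    ∫⁻ ω in {ω | (W (S ω) ω).1 ∈ B}, nexp (∑' i, if i = S ω then 0 else (W i ω).2) ∂P =
      ∫⁻ l in B, laplaceAbove κ l ∂(P.map fun ω => (W (S ω) ω).1) := by
  have hmin' : ∀ᵐ ω ∂P, ∀ i, (W (S ω) ω).1 ≤ (W i ω).1 := by
    filter_upwards [hmin] with ω hω i
    rcases eq_or_ne i (S ω) with h | h
    · rw [h]
    · exact (hω i h).le
  have hP : IsProbabilityMeasure (P.map fun ω => (W (S ω) ω).1) :=
    Measure.isProbabilityMeasure_map hS.aemeasurable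
  -- Strict minimality makes the points other than the minimal one coincide with the points strictly
  -- above it.
  have hsum : ∀ᵐ ω ∂P, (∑' i, if i = S ω then 0 else (W i ω).2) =
      sumAbove W (W (S ω) ω).1 ω := by
    filter_upwards [hmin] with ω hω
    refine tsum_congr fun i => ?_
    by_cases h : i = S ω
    · simp [h]
    · simp [h, hω i h]
  rw [lintegral_congr_ae (g := fun ω => nexp (sumAbove W (W (S ω) ω).1 ω))
    ((ae_restrict_of_ae hsum).mono fun ω hω => by simp only [hω])]
  have h1 : Tendsto (fun k => ∫⁻ ω in {ω | (W (S ω) ω).1 ∈ B},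
      nexp (sumAbove W (dyadicAbove k (W (S ω) ω).1) ω) ∂P) atTop
      (𝓝 (∫⁻ ω in {ω | (W (S ω) ω).1 ∈ B}, nexp (sumAbove W (W (S ω) ω).1 ω) ∂P)) :=
    tendsto_lintegral_of_dominated_convergence (fun _ => 1)
      (fun k => measurable_nexp.comp
        (measurable_sumAbove hW ((measurable_dyadicAbove k).comp hS)))
      (fun n => ae_of_all _ fun ω => nexp_le_one _) (by simp)
      (ae_of_all _ fun ω =>
        (continuous_nexp.tendsto _).comp (tendsto_sumAbove_dyadicAbove W _ ω))
  have h2 : Tendsto (fun k => ∫⁻ l in B, laplaceAbove κ (dyadicAbove k l)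
      ∂(P.map fun ω => (W (S ω) ω).1)) atTop
      (𝓝 (∫⁻ l in B, laplaceAbove κ l ∂(P.map fun ω => (W (S ω) ω).1))) :=
    tendsto_lintegral_of_dominated_convergence (fun _ => 1)
      (fun k => (measurable_laplaceAbove κ).comp (measurable_dyadicAbove k))
      (fun n => ae_of_all _ fun ω => nexp_le_one _) (by simp)
      (ae_of_all _ fun l => tendsto_laplaceAbove_dyadicAbove κ l)
  refine tendsto_nhds_unique h1 (h2.congr fun k => ?_)
  exact (setLIntegral_min_mem_nexp_sumAbove_dyadicAbove hκ hS hmin' k hB).symm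

end

/-! ### Gaussian integrals -/

lemma gaussianPDFReal_mul_exp (c x : ℝ) :
    gaussianPDFReal 0 1 x * Real.exp (-(c * x)) =
      Real.exp (c ^ 2 / 2) * gaussianPDFReal 0 1 (x + c) := by
  simp only [gaussianPDFReal, NNReal.coe_one, mul_one, sub_zero]
  have h : Real.exp (-x ^ 2 / 2) * Real.exp (-(c * x)) =
      Real.exp (c ^ 2 / 2) * Real.exp (-(x + c) ^ 2 / 2) := by
    rw [← Real.exp_add, ← Real.exp_add]
    ring_nf
  linear_combination (√(2 * Real.pi))⁻¹ * h

/-- Exponential tilting of a Gaussian is a translation, by completing the square. This produces the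
shifted arguments of `Q` in `M`. -/
lemma integral_mul_exp_gaussianReal (c : ℝ) (f : ℝ → ℝ) :
    ∫ x, f x * Real.exp (-(c * x)) ∂(gaussianReal 0 1) =
      Real.exp (c ^ 2 / 2) * ∫ x, f (x - c) ∂(gaussianReal 0 1) := by
  rw [integral_gaussianReal_eq_integral_smul one_ne_zero,
    integral_gaussianReal_eq_integral_smul one_ne_zero, ← integral_const_mul,
    ← integral_add_right_eq_self (fun x => Real.exp (c ^ 2 / 2) * _) c]
  refine integral_congr_ae (ae_of_all _ fun x => ?_)
  have := gaussianPDFReal_mul_exp c x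
  simp only [smul_eq_mul, add_sub_cancel_right]
  linear_combination f x * this

lemma integrable_exp_neg_mul_gaussianReal (c : ℝ) :
    Integrable (fun x => Real.exp (-(c * x))) (gaussianReal 0 1) := by
  simpa [neg_mul] using integrable_exp_mul_gaussianReal (μ := 0) (v := 1) (-c)

lemma Q_eq_integral (x : ℝ) : Q x = ∫ y in Set.Ioi x, gaussianPDFReal 0 1 y := by
  rw [Q, measureReal_def, gaussianReal_apply_eq_integral 0 one_ne_zero, ENNReal.toReal_ofReal]
  exact integral_nonneg fun y => gaussianPDFReal_nonneg 0 1 y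

lemma gaussianReal_real_Iic_neg (x : ℝ) : (gaussianReal 0 1).real (Set.Iic (-x)) = Q x := by
  have h : (gaussianReal 0 1).real (Set.Iic (-x)) = (gaussianReal 0 1).real (Set.Ici x) := by
    have := gaussianReal_map_neg (μ := 0) (v := 1)
    rw [neg_zero] at this
    conv_rhs => rw [← this, map_measureReal_apply measurable_neg measurableSet_Ici]
    congr 1
    ext y; simp
  have := nullSingletonClass_gaussianReal (μ := 0) (v := 1) one_ne_zero
  rw [h, Q, measureReal_def, measureReal_def, measure_congr Ioi_ae_eq_Ici]

lemma hasDerivAt_Q (x : ℝ) : HasDerivAt Q (-gaussianPDFReal 0 1 x) x := by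
  have hi := integrable_gaussianPDFReal 0 1
  have h : Q = fun y => Q 0 - ∫ z in (0 : ℝ)..y, gaussianPDFReal 0 1 z := by
    ext y
    rw [← intervalIntegral.integral_Ioi_sub_Ioi' (a := 0) (b := y) hi.integrableOn hi.integrableOn,
      ← Q_eq_integral, ← Q_eq_integral]
    ring
  have hc : Continuous (gaussianPDFReal 0 1) := by
    unfold gaussianPDFReal; fun_prop
  rw [h]
  exact (intervalIntegral.integral_hasDerivAt_right hi.intervalIntegrable
    (hc.stronglyMeasurableAtFilter _ _) hc.continuousAt).const_sub _

@[fun_prop] lemma differentiable_Q : Differentiable ℝ Q :=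
  fun x => (hasDerivAt_Q x).differentiableAt

/-! ### Mean area covered by a link type -/

/-- Distance at which the path loss equals `t`, for a path loss exponent `α`, and a normalized
shadowing `x`. -/
noncomputable def lossRadius (α σ m t x : ℝ) : ℝ := Real.exp ((Real.log t + m - σ * x) / α)

lemma lossRadius_pos (α σ m t x : ℝ) : 0 < lossRadius α σ m t x := Real.exp_pos _

@[fun_prop] lemma measurable_lossRadius (α σ m t : ℝ) : Measurable (lossRadius α σ m t) := by
  unfold lossRadius; fun_prop

section
variable {α σ m t D : ℝ}

lemma lossRadius_sq (hα : 0 < α) (ht : 0 < t) (x : ℝ) :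
    lossRadius α σ m t x ^ 2 =
      t ^ (2 / α) * Real.exp (2 * m / α) * Real.exp (-(2 * σ / α * x)) := by
  rw [lossRadius, ← Real.exp_nat_mul, Real.rpow_def_of_pos ht, ← Real.exp_add, ← Real.exp_add]
  congr 1
  push_cast
  field_simp
  ring

lemma integrable_lossRadius_sq (hα : 0 < α) (ht : 0 < t) :
    Integrable (fun x => lossRadius α σ m t x ^ 2) (gaussianReal 0 1) := by
  simp_rw [lossRadius_sq hα ht]
  exact (integrable_exp_neg_mul_gaussianReal _).const_mul _

lemma integral_lossRadius_sq (hα : 0 < α) (ht : 0 < t) :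
    ∫ x, lossRadius α σ m t x ^ 2 ∂(gaussianReal 0 1) =
      t ^ (2 / α) * Real.exp (2 * σ ^ 2 / α ^ 2 + 2 * m / α) := by
  simp_rw [lossRadius_sq hα ht]
  have h := integral_mul_exp_gaussianReal (2 * σ / α) (fun _ => 1)
  simp only [one_mul, integral_const, smul_eq_mul, mul_one, probReal_univ] at h
  rw [integral_const_mul, h, mul_assoc, ← Real.exp_add]
  congr 2
  field_simp
  ring

lemma integrable_min_lossRadius_sq (hD : 0 < D) :
    Integrable (fun x => min D (lossRadius α σ m t x) ^ 2) (gaussianReal 0 1) := by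
  refine Integrable.of_bound (by fun_prop) (D ^ 2) (ae_of_all _ fun x => ?_)
  have h := lossRadius_pos α σ m t x
  rw [Real.norm_of_nonneg (by positivity)]
  exact pow_le_pow_left₀ (le_min hD.le h.le) (min_le_left _ _) 2

/-- The radius decreases in the shadowing `x` and crosses `D` at `x = -u`. Below the crossing the
integrand is `D ^ 2`, with Gaussian mass `Q u`; above it the squared radius is an exponential in
`x`, and tilting gives the other tail. -/
lemma integral_min_lossRadius_sq (hα : 0 < α) (hσ : 0 < σ) (hD : 0 < D) (ht : 0 < t) :
    ∫ x, min D (lossRadius α σ m t x) ^ 2 ∂(gaussianReal 0 1) =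
      D ^ 2 * Q ((Real.log (D ^ α / t) - m) / σ) +
      t ^ (2 / α) * Real.exp (2 * σ ^ 2 / α ^ 2 + 2 * m / α) *
        Q (2 * σ ^ 2 / (α * σ) - (Real.log (D ^ α / t) - m) / σ) := by
  set u := (Real.log (D ^ α / t) - m) / σ with hu
  have hlog : Real.log (D ^ α / t) = α * Real.log D - Real.log t := by
    rw [Real.log_div (by positivity) ht.ne', Real.log_rpow hD]
  have hD' : ∀ x, D ≤ lossRadius α σ m t x ↔ x ≤ -u := by
    intro x
    rw [lossRadius, ← Real.log_le_iff_le_exp hD, le_div_iff₀ hα, hu, hlog, ← neg_div,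
      le_div_iff₀ hσ]
    constructor <;> intro h <;> linarith
  have hpt : ∀ x, min D (lossRadius α σ m t x) ^ 2 =
      (Set.Iic (-u)).indicator (fun _ => D ^ 2) x +
      t ^ (2 / α) * Real.exp (2 * m / α) *
        ((Set.Ioi (-u)).indicator (fun _ => 1) x * Real.exp (-(2 * σ / α * x))) := by
    intro x
    by_cases h : x ≤ -u
    · have h' : ¬ -u < x := not_lt.2 h
      simp [h, h', min_eq_left ((hD' x).2 h)]
    · have h' : -u < x := not_le.1 h
      have := mt (hD' x).1 h
      simp [h, h', min_eq_right (not_le.1 this).le, lossRadius_sq hα ht]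
  simp_rw [hpt]
  have hi : Integrable (fun x => (Set.Ioi (-u)).indicator (fun _ => (1 : ℝ)) x *
      Real.exp (-(2 * σ / α * x))) (gaussianReal 0 1) := by
    refine ((integrable_exp_neg_mul_gaussianReal (2 * σ / α)).indicator
      (measurableSet_Ioi (a := -u))).congr (ae_of_all _ fun x => ?_)
    by_cases h : x ∈ Set.Ioi (-u) <;> simp [h]
  have hs : ∀ x : ℝ, (Set.Ioi (-u)).indicator (fun _ => (1 : ℝ)) (x - 2 * σ / α) =
      (Set.Ioi (2 * σ / α - u)).indicator (fun _ => (1 : ℝ)) x := by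
    intro x
    simp only [Set.indicator_apply, Set.mem_Ioi]
    congr 1
    rw [eq_iff_iff]
    constructor <;> intro h <;> linarith
  rw [integral_add ((integrable_const _).indicator measurableSet_Iic) (hi.const_mul _),
    integral_indicator_const _ measurableSet_Iic, integral_const_mul,
    integral_mul_exp_gaussianReal]
  simp_rw [hs]
  rw [integral_indicator_const _ measurableSet_Ioi, gaussianReal_real_Iic_neg,
    show 2 * σ ^ 2 / (α * σ) = 2 * σ / α by field_simp]
  change Q u * D ^ 2 + _ * (_ * (Q _ * 1)) = _
  rw [Real.exp_add, show (2 * σ / α) ^ 2 / 2 = 2 * σ ^ 2 / α ^ 2 by field_simp]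
  ring

end

/-! ### The mean number of links of bounded loss -/

lemma lintegral_bernoulliMeasure_true_false (q : unitInterval) (f : Bool → ℝ≥0∞) :
    ∫⁻ b, f b ∂(bernoulliMeasure true false q) =
      ENNReal.ofReal q * f true + ENNReal.ofReal (1 - q) * f false := by
  rw [bernoulliMeasure_def, lintegral_add_measure]
  have h1 : ∀ (a : ℝ≥0) (b : Bool), ∫⁻ x, f x ∂(a • Measure.dirac b) = a * f b := by
    intro a b
    rw [lintegral_smul_measure, lintegral_dirac]; rfl
  rw [h1, h1]
  congr 2
  · rw [← ENNReal.ofReal_coe_nnreal]; rfl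
  · rw [← ENNReal.ofReal_coe_nnreal]; rfl

namespace Params
variable (p : Params)

lemma sigmaL_pos : 0 < p.sigmaL := by
  have := p.xiL_pos
  have := Real.log_pos (show (1 : ℝ) < 10 by norm_num)
  unfold sigmaL; positivity

lemma sigmaN_pos : 0 < p.sigmaN := by
  have := p.xiN_pos
  have := Real.log_pos (show (1 : ℝ) < 10 by norm_num)
  unfold sigmaN; positivity

/-- The path loss as a function of position, LOS indicator and shadowing. -/
noncomputable def linkLoss (y : Plane) (b : Bool) (x : ℝ) : ℝ := p.loss y ⟨b, x, 0, 0, 0⟩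

lemma loss_eq_linkLoss (y : Plane) (k : Mark) : p.loss y k = p.linkLoss y k.clear k.shadow := rfl

lemma linkLoss_pos (y : Plane) (b : Bool) (x : ℝ) : 0 < p.linkLoss y b x := by
  unfold linkLoss loss; positivity

/-- Passing from decibels to natural logarithms turns `β` and `ξ` into `-m` and `σ`. -/
lemma linkLoss_eq {y : Plane} (b : Bool) (x : ℝ) :
    p.linkLoss y b x = if ‖y‖ ≤ p.D ∧ b = true then
      Real.exp (p.alphaL * Real.log ‖y‖ + p.sigmaL * x - p.m) else
      Real.exp (p.alphaN * Real.log ‖y‖ + p.sigmaN * x - p.m) := by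
  have h10 : Real.log 10 ≠ 0 := (Real.log_pos (by norm_num)).ne'
  unfold linkLoss loss lossDB
  simp only
  split_ifs
  all_goals
    rw [Real.rpow_def_of_pos (by norm_num)]
    congr 1
    simp only [sigmaL, sigmaN, m, Real.logb]
    field_simp
    ring

attribute [irreducible] linkLoss

/-- The origin is excluded because the convention `Real.log 0 = 0` gives it a positive loss; it is a
null set. -/
lemma linkLoss_le_iff {y : Plane} (hy : y ≠ 0) (b : Bool) (x : ℝ) {t : ℝ} (ht : 0 < t) :
    p.linkLoss y b x ≤ t ↔ if ‖y‖ ≤ p.D ∧ b = true then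
      ‖y‖ ≤ lossRadius p.alphaL p.sigmaL p.m t x else
      ‖y‖ ≤ lossRadius p.alphaN p.sigmaN p.m t x := by
  have hy' : 0 < ‖y‖ := norm_pos_iff.2 hy
  rw [linkLoss_eq]
  have hL := p.alphaL_pos
  have hN := p.alphaN_pos
  split_ifs
  all_goals
    rw [← Real.le_log_iff_exp_le ht, lossRadius, ← Real.log_le_iff_le_exp hy',
      le_div_iff₀ (by assumption)]
    constructor <;> intro h <;> linarith

lemma measurable_linkLoss : Measurable fun z : Plane × Bool × ℝ => p.linkLoss z.1 z.2.1 z.2.2 := by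
  simp_rw [linkLoss_eq]
  refine Measurable.ite ?_ (by fun_prop) (by fun_prop)
  exact (measurableSet_le measurable_fst.norm measurable_const).inter
    ((measurable_fst.comp measurable_snd) (measurableSet_singleton true))

/-- Area of the positions at which a BS has a loss of at most `t`. -/
noncomputable def lossArea (t : ℝ) (b : Bool) (x : ℝ) : ℝ :=
  if b = true then
    Real.pi * min p.D (lossRadius p.alphaL p.sigmaL p.m t x) ^ 2 +
      (Real.pi * lossRadius p.alphaN p.sigmaN p.m t x ^ 2 -
        Real.pi * min p.D (lossRadius p.alphaN p.sigmaN p.m t x) ^ 2)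
  else Real.pi * lossRadius p.alphaN p.sigmaN p.m t x ^ 2

lemma min_lossRadius_sq_le (α σ m t x : ℝ) :
    min p.D (lossRadius α σ m t x) ^ 2 ≤ lossRadius α σ m t x ^ 2 :=
  pow_le_pow_left₀ (le_min p.D_pos.le (lossRadius_pos _ _ _ _ _).le) (min_le_right _ _) 2

lemma lossArea_nonneg (t : ℝ) (b : Bool) (x : ℝ) : 0 ≤ p.lossArea t b x := by
  have h := mul_le_mul_of_nonneg_left
    (p.min_lossRadius_sq_le p.alphaN p.sigmaN p.m t x) Real.pi_pos.le
  have hL := lossRadius_pos p.alphaL p.sigmaL p.m t x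
  have hN := lossRadius_pos p.alphaN p.sigmaN p.m t x
  have hD := p.D_pos
  unfold lossArea
  split_ifs
  · have : 0 ≤ Real.pi * min p.D (lossRadius p.alphaL p.sigmaL p.m t x) ^ 2 := by positivity
    linarith
  · positivity

lemma volume_closedBall_plane {r : ℝ} (hr : 0 ≤ r) :
    volume (Metric.closedBall (0 : Plane) r) = ENNReal.ofReal (Real.pi * r ^ 2) := by
  rw [EuclideanSpace.volume_closedBall_fin_two, mul_comm Real.pi,
    ENNReal.ofReal_mul (by positivity), ENNReal.ofReal_pow hr]

lemma volume_congr_of_ne_zero {A B : Set Plane} (h : ∀ y ≠ 0, y ∈ A ↔ y ∈ B) :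
    volume A = volume B := by
  have h0 : ∀ᵐ y : Plane, y ≠ 0 := by
    rw [ae_iff]; simp
  refine measure_congr ?_
  filter_upwards [h0] with y hy
  exact propext (h y hy)

lemma volume_linkLoss_le {t : ℝ} (ht : 0 < t) (b : Bool) (x : ℝ) :
    volume {y : Plane | p.linkLoss y b x ≤ t} = ENNReal.ofReal (p.lossArea t b x) := by
  have hL := lossRadius_pos p.alphaL p.sigmaL p.m t x
  have hN := lossRadius_pos p.alphaN p.sigmaN p.m t x
  have hD := p.D_pos
  unfold lossArea
  cases b with
  | true =>
    set rL := lossRadius p.alphaL p.sigmaL p.m t x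
    set rN := lossRadius p.alphaN p.sigmaN p.m t x
    -- LOS positions fill a disc cut off at `D`, and NLOS positions the annulus `D < ‖y‖ ≤ rN`.
    -- Writing the annulus with `min p.D rN` makes it a difference of nested balls, empty when `rN ≤
    -- D`.
    have he : volume {y : Plane | p.linkLoss y true x ≤ t} = volume
        (Metric.closedBall 0 (min p.D rL) ∪
          (Metric.closedBall 0 rN \ Metric.closedBall 0 (min p.D rN)) : Set Plane) := by
      refine volume_congr_of_ne_zero fun y hy => ?_
      change p.linkLoss y true x ≤ t ↔ _
      rw [p.linkLoss_le_iff hy true x ht]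
      simp only [Set.mem_union, Set.mem_sdiff, mem_closedBall_zero_iff, le_min_iff, and_true]
      by_cases h : ‖y‖ ≤ p.D <;> simp [h, rL, rN]
    have hd : Disjoint (Metric.closedBall (0 : Plane) (min p.D rL))
        (Metric.closedBall 0 rN \ Metric.closedBall 0 (min p.D rN)) := by
      rw [Set.disjoint_left]
      intro y hy hy'
      simp only [Set.mem_sdiff, mem_closedBall_zero_iff, le_min_iff] at hy hy'
      tauto
    have hsub : Metric.closedBall (0 : Plane) (min p.D rN) ⊆ Metric.closedBall 0 rN :=
      Metric.closedBall_subset_closedBall (min_le_right _ _)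
    rw [he, measure_union hd
      (Metric.isClosed_closedBall.measurableSet.diff Metric.isClosed_closedBall.measurableSet),
      measure_sdiff hsub Metric.isClosed_closedBall.measurableSet.nullMeasurableSet
        measure_closedBall_lt_top.ne,
      volume_closedBall_plane (by positivity), volume_closedBall_plane (by positivity),
      volume_closedBall_plane (by positivity), ← ENNReal.ofReal_sub _ (by positivity),
      ← ENNReal.ofReal_add (by positivity)]
    · simp
    · have := p.min_lossRadius_sq_le p.alphaN p.sigmaN p.m t x
      have := mul_le_mul_of_nonneg_left this Real.pi_pos.le
      linarith
  | false =>
    have he : volume {y : Plane | p.linkLoss y false x ≤ t} = volume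
        (Metric.closedBall 0 (lossRadius p.alphaN p.sigmaN p.m t x) : Set Plane) := by
      refine volume_congr_of_ne_zero fun y hy => ?_
      change p.linkLoss y false x ≤ t ↔ _
      rw [p.linkLoss_le_iff hy false x ht]
      simp
    rw [he, volume_closedBall_plane (by positivity)]
    simp

/-- Intensity measure of the path losses, for a unit density of BSs. -/
noncomputable def lossIntensity : Measure ℝ :=
  ((volume : Measure Plane).prod
    ((bernoulliMeasure true false p.pLOS).prod (gaussianReal 0 1))).map
    fun z => p.linkLoss z.1 z.2.1 z.2.2

/-- This identifies the closed form with a mean covered area, from which its sign and monotonicity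
follow without differentiating it. -/
lemma M_eq {t : ℝ} (ht : 0 < t) :
    p.M t = p.pLOS * ∫ x, p.lossArea t true x ∂(gaussianReal 0 1) +
      (1 - p.pLOS) * ∫ x, p.lossArea t false x ∂(gaussianReal 0 1) := by
  have hmL := integrable_min_lossRadius_sq (α := p.alphaL) (σ := p.sigmaL) (m := p.m) (t := t)
    p.D_pos
  have hmN := integrable_min_lossRadius_sq (α := p.alphaN) (σ := p.sigmaN) (m := p.m) (t := t)
    p.D_pos
  have hN := integrable_lossRadius_sq (σ := p.sigmaN) (m := p.m) p.alphaN_pos ht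
  simp only [lossArea, if_true, Bool.false_eq_true, if_false]
  have hd : Integrable (fun x => Real.pi * lossRadius p.alphaN p.sigmaN p.m t x ^ 2 -
      Real.pi * min p.D (lossRadius p.alphaN p.sigmaN p.m t x) ^ 2) (gaussianReal 0 1) :=
    (hN.const_mul _).sub (hmN.const_mul _)
  rw [integral_add (hmL.const_mul _) hd,
    integral_sub (hN.const_mul _) (hmN.const_mul _), integral_const_mul, integral_const_mul,
    integral_const_mul,
    integral_min_lossRadius_sq p.alphaL_pos p.sigmaL_pos p.D_pos ht,
    integral_min_lossRadius_sq p.alphaN_pos p.sigmaN_pos p.D_pos ht,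
    integral_lossRadius_sq p.alphaN_pos ht]
  simp only [M, ML, MN, upsL, upsN]
  ring

lemma integrable_lossArea {t : ℝ} (ht : 0 < t) (b : Bool) :
    Integrable (p.lossArea t b) (gaussianReal 0 1) := by
  have hmL := integrable_min_lossRadius_sq (α := p.alphaL) (σ := p.sigmaL) (m := p.m) (t := t)
    p.D_pos
  have hmN := integrable_min_lossRadius_sq (α := p.alphaN) (σ := p.sigmaN) (m := p.m) (t := t)
    p.D_pos
  have hN := integrable_lossRadius_sq (σ := p.sigmaN) (m := p.m) p.alphaN_pos ht
  cases b
  · exact hN.const_mul _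
  · exact (hmL.const_mul _).add ((hN.const_mul _).sub (hmN.const_mul _))

lemma M_nonneg {t : ℝ} (ht : 0 < t) : 0 ≤ p.M t := by
  rw [p.M_eq ht]
  have h : ∀ b, 0 ≤ ∫ x, p.lossArea t b x ∂(gaussianReal 0 1) :=
    fun b => integral_nonneg (p.lossArea_nonneg t b)
  exact add_nonneg (mul_nonneg p.pLOS.2.1 (h _)) (mul_nonneg (by linarith [p.pLOS.2.2]) (h _))

lemma lossIntensity_Iic {t : ℝ} (ht : 0 < t) :
    p.lossIntensity (Set.Iic t) = ENNReal.ofReal (p.M t) := by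
  have hb : ∀ b, ∫⁻ x, ENNReal.ofReal (p.lossArea t b x) ∂(gaussianReal 0 1) =
      ENNReal.ofReal (∫ x, p.lossArea t b x ∂(gaussianReal 0 1)) := fun b =>
    (ofReal_integral_eq_lintegral_ofReal (p.integrable_lossArea ht b)
      (ae_of_all _ (p.lossArea_nonneg t b))).symm
  have h : ∀ b, 0 ≤ ∫ x, p.lossArea t b x ∂(gaussianReal 0 1) :=
    fun b => integral_nonneg (p.lossArea_nonneg t b)
  rw [lossIntensity, Measure.map_apply p.measurable_linkLoss measurableSet_Iic,
    Measure.prod_apply_symm (p.measurable_linkLoss measurableSet_Iic)]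
  have hs : ∀ z : Bool × ℝ, volume ((fun y : Plane => (y, z)) ⁻¹'
      ((fun z : Plane × Bool × ℝ => p.linkLoss z.1 z.2.1 z.2.2) ⁻¹' Set.Iic t)) =
      ENNReal.ofReal (p.lossArea t z.1 z.2) := fun z => p.volume_linkLoss_le ht z.1 z.2
  have hm : Measurable fun z : Bool × ℝ => ENNReal.ofReal (p.lossArea t z.1 z.2) := by
    refine measurable_from_prod_countable_right fun b => ENNReal.measurable_ofReal.comp ?_
    unfold lossArea
    cases b <;> simp <;> fun_prop
  simp_rw [hs]
  rw [lintegral_prod _ hm.aemeasurable, lintegral_bernoulliMeasure_true_false, hb, hb,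
    ← ENNReal.ofReal_mul p.pLOS.2.1, ← ENNReal.ofReal_mul (by linarith [p.pLOS.2.2]),
    ← ENNReal.ofReal_add (mul_nonneg p.pLOS.2.1 (h _))
      (mul_nonneg (by linarith [p.pLOS.2.2]) (h _)), ← p.M_eq ht]

lemma monotoneOn_M : MonotoneOn p.M (Set.Ioi 0) := by
  intro a ha b hb hab
  rw [← ENNReal.ofReal_le_ofReal_iff (p.M_nonneg hb), ← p.lossIntensity_Iic ha,
    ← p.lossIntensity_Iic hb]
  exact measure_mono (Set.Iic_subset_Iic.2 hab)

lemma differentiableAt_M {t : ℝ} (ht : 0 < t) : DifferentiableAt ℝ p.M t := by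
  have hD : ∀ α : ℝ, p.D ^ α / t ≠ 0 := fun α =>
    (div_pos (Real.rpow_pos_of_pos p.D_pos α) ht).ne'
  have ht' := ht.ne'
  have hlog : ∀ α : ℝ, DifferentiableAt ℝ (fun t => Real.log (p.D ^ α / t)) t := fun α =>
    ((differentiableAt_const _).div differentiableAt_id ht').log (hD α)
  have hL : DifferentiableAt ℝ p.upsL t := ((hlog _).sub_const _).div_const _
  have hN : DifferentiableAt ℝ p.upsN t := ((hlog _).sub_const _).div_const _
  have hQ : ∀ {f : ℝ → ℝ}, DifferentiableAt ℝ f t → DifferentiableAt ℝ (fun t => Q (f t)) t :=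
    fun hf => (differentiable_Q _).comp t hf
  have hr : ∀ α : ℝ, DifferentiableAt ℝ (fun t : ℝ => t ^ α) t := fun α =>
    Real.differentiableAt_rpow_const_of_ne α ht'
  refine DifferentiableAt.add ?_ ?_
  · exact (((hQ hL).const_mul _).add (((hr _).mul_const _).mul (hQ (hL.const_sub _)))).const_mul _
  · exact ((hQ hN).const_mul _).add ((((hr _).const_mul _).mul_const _).mul
      (((hQ (hN.const_sub _)).const_mul _).const_sub _))

lemma deriv_M_nonneg {t : ℝ} (ht : 0 < t) : 0 ≤ deriv p.M t := by
  rw [← derivWithin_of_isOpen isOpen_Ioi ht]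
  exact p.monotoneOn_M.derivWithin_nonneg

/-- Both measures give `Ioc a b`, cut to `(l, ∞)`, an increment of `M`: one by `lossIntensity_Iic`,
the other by the fundamental theorem of calculus. Staying above `l > 0` keeps the masses finite and
`M` differentiable. -/
lemma restrict_lossIntensity {l : ℝ} (hl : 0 < l) :
    p.lossIntensity.restrict (Set.Ioi l) =
      (volume.restrict (Set.Ioi l)).withDensity fun t => ENNReal.ofReal (deriv p.M t) := by
  have hI : ∀ a b : ℝ, 0 < a → a ≤ b → p.lossIntensity (Set.Ioc a b) =
      ENNReal.ofReal (p.M b - p.M a) := by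
    intro a b ha hab
    rw [← Set.Iic_sdiff_Iic, measure_sdiff (Set.Iic_subset_Iic.2 hab)
      measurableSet_Iic.nullMeasurableSet (by rw [p.lossIntensity_Iic ha]; simp),
      p.lossIntensity_Iic ha, p.lossIntensity_Iic (ha.trans_le hab),
      ENNReal.ofReal_sub _ (p.M_nonneg ha)]
  refine Measure.ext_of_Ioc' _ _ (fun a b _ => ?_) fun a b _ => ?_
  · refine ne_top_of_le_ne_top ?_ ((Measure.restrict_apply_le _ _).trans
      (measure_mono (Set.Ioc_subset_Iic_self.trans (Set.Iic_subset_Iic.2 (le_max_left b l)))))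
    rw [p.lossIntensity_Iic (lt_max_of_lt_right hl)]
    simp
  · rw [withDensity_apply _ measurableSet_Ioc, Measure.restrict_restrict measurableSet_Ioc,
      Measure.restrict_apply measurableSet_Ioc, Set.Ioc_inter_Ioi]
    rcases le_or_gt (max a l) b with h | h
    · have hc : 0 < max a l := lt_max_of_lt_right hl
      have hd : ∀ x ∈ Set.Icc (max a l) b, HasDerivAt p.M (deriv p.M x) x := fun x hx =>
        (p.differentiableAt_M (hc.trans_le hx.1)).hasDerivAt
      -- Integrability comes from the sign of the derivative, so continuity of `M'` need not be
      -- checked.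
      have hint : IntegrableOn (deriv p.M) (Set.Ioc (max a l) b) :=
        intervalIntegral.integrableOn_deriv_of_nonneg
          (fun x hx => (hd x hx).continuousAt.continuousWithinAt)
          (fun x hx => hd x (Set.Ioo_subset_Icc_self hx))
          (fun x hx => p.deriv_M_nonneg (hc.trans hx.1))
      have hftc : ∫ x in (max a l)..b, deriv p.M x = p.M b - p.M (max a l) := by
        refine intervalIntegral.integral_eq_sub_of_hasDerivAt (fun x hx => hd x ?_)
          ((intervalIntegrable_iff_integrableOn_Ioc_of_le h).2 hint)
        rwa [Set.uIcc_of_le h] at hx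
      rw [hI _ _ hc h, ← hftc, intervalIntegral.integral_of_le h,
        ofReal_integral_eq_lintegral_ofReal hint]
      filter_upwards [ae_restrict_mem measurableSet_Ioc] with x hx
      exact p.deriv_M_nonneg (hc.trans hx.1)
    · simp [Set.Ioc_eq_empty_of_le h.le]

end Params

/-! ### Beam collision probabilities -/

section angleProb
variable {N : ℕ}

/-- For `i < N` this is monotonicity of `arcsin`. Otherwise the subtracted sum telescopes to a
single difference of arcsines, at most `π`, the length of the range of `arcsin`. -/
lemma angleProb_nonneg (hN : 1 ≤ N) (i : ℕ) : 0 ≤ angleProb N i := by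
  have hN' : (0 : ℝ) < N := by exact_mod_cast hN
  unfold angleProb
  simp only
  split_ifs with h
  · refine div_nonneg (sub_nonneg.2 (Real.monotone_arcsin ?_)) Real.pi_pos.le
    gcongr
    linarith
  · let f : ℕ → ℝ := fun i => Real.arcsin (-1 + (2 * i - 1) / N)
    have hs : ∑ j ∈ Finset.Ico 1 N, (Real.arcsin (-1 + (2 * j + 1) / N) -
        Real.arcsin (-1 + (2 * j - 1) / N)) / Real.pi = (f N - f 1) / Real.pi := by
      rw [← Finset.sum_div, ← Finset.sum_Ico_sub f hN]
      congr 1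
      refine Finset.sum_congr rfl fun j _ => ?_
      simp only [f]
      push_cast
      congr 4
      ring
    rw [hs, sub_nonneg, div_le_one Real.pi_pos]
    have h1 := Real.arcsin_le_pi_div_two (-1 + (2 * (N : ℝ) - 1) / N)
    have h2 := Real.neg_pi_div_two_le_arcsin (-1 + (2 * ((1 : ℕ) : ℝ) - 1) / N)
    simp only [f]
    linarith

lemma sum_angleProb (hN : 1 ≤ N) : ∑ i ∈ Finset.Icc 1 N, angleProb N i = 1 := by
  rw [← Finset.Ico_insert_right hN, Finset.sum_insert (by simp)]
  have h : ∀ j ∈ Finset.Ico 1 N, angleProb N j = (Real.arcsin (-1 + (2 * j + 1) / N) -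
        Real.arcsin (-1 + (2 * j - 1) / N)) / Real.pi := by
    intro j hj
    simp [angleProb, (Finset.mem_Ico.1 hj).2]
  rw [Finset.sum_congr rfl h]
  simp [angleProb]

lemma angleProb_le_one (hN : 1 ≤ N) {i : ℕ} (hi : i ∈ Finset.Icc 1 N) : angleProb N i ≤ 1 := by
  rw [← sum_angleProb hN]
  exact Finset.single_le_sum (fun j _ => angleProb_nonneg hN j) hi

end angleProb

/-! ### Rayleigh fading -/

lemma measurable_complex_mk : Measurable fun z : ℝ × ℝ => (⟨z.1, z.2⟩ : ℂ) :=
  Complex.measurableEquivRealProd.symm.measurable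

instance : IsProbabilityMeasure stdComplexNormal :=
  Measure.isProbabilityMeasure_map measurable_complex_mk.aemeasurable

/-- With variance `1/2` the density is `exp (-x ^ 2) / √π`, so the factor only changes the rate from
`1` to `1 + c`. -/
lemma lintegral_nexp_sq_gaussianReal {c : ℝ} (hc : 0 ≤ c) :
    ∫⁻ x, nexp (ENNReal.ofReal (c * x ^ 2)) ∂(gaussianReal 0 (1 / 2)) =
      ENNReal.ofReal (√(1 / (1 + c))) := by
  have hv : (1 / 2 : ℝ≥0) ≠ 0 := by norm_num
  have hb : ∀ x : ℝ, Real.exp (-(c * x ^ 2)) ≤ 1 := fun x => by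
    rw [Real.exp_le_one_iff]; nlinarith [mul_nonneg hc (sq_nonneg x)]
  have hi : Integrable (fun x : ℝ => Real.exp (-(c * x ^ 2))) (gaussianReal 0 (1 / 2)) :=
    Integrable.of_bound (by fun_prop) 1 (ae_of_all _ fun x => by
      rw [Real.norm_of_nonneg (Real.exp_pos _).le]; exact hb x)
  have h : ∀ x : ℝ, nexp (ENNReal.ofReal (c * x ^ 2)) =
      ENNReal.ofReal (Real.exp (-(c * x ^ 2))) := fun x => nexp_ofReal (by positivity)
  simp_rw [h]
  rw [← ofReal_integral_eq_lintegral_ofReal hi (ae_of_all _ fun x => (Real.exp_pos _).le),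
    integral_gaussianReal_eq_integral_smul hv]
  congr 1
  have hp : ∀ x : ℝ, gaussianPDFReal 0 (1 / 2) x • Real.exp (-(c * x ^ 2)) =
      (√Real.pi)⁻¹ * Real.exp (-(1 + c) * x ^ 2) := by
    intro x
    have h2 : ((1 / 2 : ℝ≥0) : ℝ) = 1 / 2 := by norm_num
    rw [gaussianPDFReal, smul_eq_mul, mul_assoc, ← Real.exp_add, h2]
    congr 2
    · congr 1; ring_nf
    · ring
  simp_rw [hp]
  rw [integral_const_mul, integral_gaussian, Real.sqrt_div' _ (by positivity),
    Real.sqrt_div' _ (by positivity), Real.sqrt_one]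
  have : √Real.pi ≠ 0 := (Real.sqrt_pos.2 Real.pi_pos).ne'
  field_simp

/-- The real and imaginary parts each contribute `√(1 / (1 + c))`; equivalently, `‖z‖ ^ 2` has the
Laplace transform of a unit exponential variable. -/
lemma lintegral_one_sub_nexp_stdComplexNormal {c : ℝ} (hc : 0 ≤ c) :
    ∫⁻ z, (1 - nexp (ENNReal.ofReal (c * ‖z‖ ^ 2))) ∂stdComplexNormal =
      ENNReal.ofReal (c / (1 + c)) := by
  have hm : Measurable fun z : ℂ => nexp (ENNReal.ofReal (c * ‖z‖ ^ 2)) := by fun_prop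
  have hm1 : Measurable fun x : ℝ => nexp (ENNReal.ofReal (c * x ^ 2)) := by fun_prop
  have hint : ∫⁻ z, nexp (ENNReal.ofReal (c * ‖z‖ ^ 2)) ∂stdComplexNormal =
      ENNReal.ofReal (1 / (1 + c)) := by
    rw [stdComplexNormal, lintegral_map hm measurable_complex_mk]
    have : ∀ w : ℝ × ℝ, nexp (ENNReal.ofReal (c * ‖(⟨w.1, w.2⟩ : ℂ)‖ ^ 2)) =
        nexp (ENNReal.ofReal (c * w.1 ^ 2)) * nexp (ENNReal.ofReal (c * w.2 ^ 2)) := by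
      intro w
      rw [← nexp_add, ← ENNReal.ofReal_add (by positivity) (by positivity), Complex.sq_norm,
        Complex.normSq_mk]
      ring_nf
    simp_rw [this]
    rw [lintegral_prod_mul hm1.aemeasurable hm1.aemeasurable, lintegral_nexp_sq_gaussianReal hc,
      ← ENNReal.ofReal_mul (by positivity), Real.mul_self_sqrt (by positivity)]
  rw [lintegral_sub hm (by rw [hint]; simp) (ae_of_all _ fun z => nexp_le_one _), hint,
    lintegral_const, measure_univ, mul_one, ← ENNReal.ofReal_one,
    ← ENNReal.ofReal_sub _ (by positivity)]
  congr 1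
  field_simp
  ring

namespace Params
variable (p : Params)

lemma G_pos : 0 < p.G := by
  have h1 : (0 : ℝ) < p.NBS := by exact_mod_cast p.NBS_pos
  have h2 : (0 : ℝ) < p.NUE := by exact_mod_cast p.NUE_pos
  have h3 := p.power_pos
  unfold G; positivity

lemma alignProb_nonneg : 0 ≤ p.alignProb := Finset.sum_nonneg fun _ _ => sq_nonneg _

lemma alignProb_le_one : p.alignProb ≤ 1 := by
  rw [← sum_angleProb p.NUE_pos]
  refine Finset.sum_le_sum fun i hi => ?_
  have h0 := angleProb_nonneg p.NUE_pos i
  have h1 := angleProb_le_one p.NUE_pos hi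
  nlinarith

lemma collisionProb_nonneg (n k : ℕ) : 0 ≤ p.collisionProb n k := by
  refine mul_nonneg (Nat.cast_nonneg _) (Finset.sum_nonneg fun i hi => ?_)
  exact mul_nonneg (pow_nonneg (angleProb_nonneg p.NBS_pos i) _)
    (pow_nonneg (sub_nonneg.2 (angleProb_le_one p.NBS_pos hi)) _)

lemma beamGain_nonneg {n k : ℕ} (hk : k ≤ n) : 0 ≤ p.beamGain n k := by
  have : (k : ℝ) ≤ n := by exact_mod_cast hk
  unfold beamGain
  exact add_nonneg (Nat.cast_nonneg _) (mul_nonneg (by linarith) (sq_nonneg _))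

lemma beamGain_zero_zero : p.beamGain 0 0 = 0 := by simp [beamGain]

/-- Take `c = s G v / (t n)` in `c / (1 + c) = 1 / (1 + 1 / c)`. For `n = 0` division by zero makes
the left side vanish, and `v = 0` is what makes `kernel` vanish too. -/
lemma lintegral_one_sub_nexp_fading {s t v : ℝ} {n : ℕ} (hs : 0 ≤ s) (ht : 0 < t) (hv : 0 ≤ v)
    (hn : n = 0 → v = 0) :
    ∫⁻ z : ℂ, (1 - nexp (ENNReal.ofReal s * ENNReal.ofReal (p.G * ‖z‖ ^ 2 * t⁻¹ * v / n)))
      ∂stdComplexNormal = ENNReal.ofReal (p.kernel s v n t) := by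
  have hG := p.G_pos
  have h : ∀ z : ℂ, ENNReal.ofReal s * ENNReal.ofReal (p.G * ‖z‖ ^ 2 * t⁻¹ * v / n) =
      ENNReal.ofReal (s * p.G * t⁻¹ * v / n * ‖z‖ ^ 2) := by
    intro z
    rw [← ENNReal.ofReal_mul hs]
    congr 1; ring
  simp_rw [h]
  rw [lintegral_one_sub_nexp_stdComplexNormal (by positivity)]
  congr 1
  unfold kernel
  split_ifs with h0
  · have : s * p.G * t⁻¹ * v / n = 0 := by
      rw [show s * p.G * t⁻¹ * v / n = s * p.G * v * (t⁻¹ / n) by ring, h0, zero_mul]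
    simp [this]
  · have hv0 : v ≠ 0 := right_ne_zero_of_mul h0
    have hs0 : s ≠ 0 := left_ne_zero_of_mul (left_ne_zero_of_mul h0)
    have hn0 : (n : ℝ) ≠ 0 := by
      intro h'; exact hv0 (hn (by exact_mod_cast h'))
    have hn1 : (0 : ℝ) < n := lt_of_le_of_ne (Nat.cast_nonneg _) hn0.symm
    have hs1 : 0 < s := lt_of_le_of_ne hs hs0.symm
    have hv1 : 0 < v := lt_of_le_of_ne hv hv0.symm
    field_simp
    ring

/-! ### The exponent -/

lemma lintegral_loadGainLaw (f : ℕ × ℝ → ℝ≥0∞) (hf : Measurable f) :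
    ∫⁻ q, f q ∂p.loadGainLaw = ∑ n ∈ Finset.range (p.UM + 1), ENNReal.ofReal (p.loadPMF n) *
      ∑ k ∈ Finset.range (n + 1), ENNReal.ofReal (p.collisionProb n k) *
        (ENNReal.ofReal p.alignProb * f (n, p.beamGain n k) +
          ENNReal.ofReal (1 - p.alignProb) * f (n, p.rhoUE ^ 2 * p.beamGain n k)) := by
  have ha := p.alignProb_nonneg
  have ha' := sub_nonneg.2 p.alignProb_le_one
  rw [loadGainLaw, lintegral_finsetSum_measure]
  refine Finset.sum_congr rfl fun n _ => ?_
  rw [lintegral_finsetSum_measure, Finset.mul_sum]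
  refine Finset.sum_congr rfl fun k _ => ?_
  have hc := p.collisionProb_nonneg n k
  rw [lintegral_add_measure, lintegral_smul_measure, lintegral_smul_measure,
    lintegral_dirac' _ hf, lintegral_dirac' _ hf, ENNReal.ofReal_mul' (mul_nonneg ha hc),
    ENNReal.ofReal_mul' (mul_nonneg ha' hc), ENNReal.ofReal_mul ha, ENNReal.ofReal_mul ha',
    smul_eq_mul, smul_eq_mul]
  ring

instance : IsFiniteMeasure p.loadGainLaw := by
  constructor
  rw [← lintegral_one, p.lintegral_loadGainLaw _ measurable_const]
  refine ENNReal.sum_lt_top.2 fun n _ => ENNReal.mul_lt_top ENNReal.ofReal_lt_top ?_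
  refine ENNReal.sum_lt_top.2 fun k _ => ENNReal.mul_lt_top ENNReal.ofReal_lt_top ?_
  simp

/-- Position, LOS indicator and shadowing enter only through the loss, so their joint measure can be
pushed forward to `lossIntensity`, leaving fading, load and gain independent of it. -/
lemma lintegral_prod_markLaw {F : ℝ → ℂ × (ℕ × ℝ) → ℝ≥0∞}
    (hF : Measurable (Function.uncurry F)) :
    ∫⁻ w, F (p.linkLoss w.1 w.2.1 w.2.2.1) w.2.2.2
      ∂((ENNReal.ofReal p.lamBS • (volume : Measure Plane)).prod p.markLaw) =
    ENNReal.ofReal p.lamBS *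
      ∫⁻ t, ∫⁻ r, F t r ∂(stdComplexNormal.prod p.loadGainLaw) ∂p.lossIntensity := by
  have hl := p.measurable_linkLoss
  have hm : Measurable fun w : Plane × Bool × ℝ × (ℂ × (ℕ × ℝ)) =>
      F (p.linkLoss w.1 w.2.1 w.2.2.1) w.2.2.2 := by
    refine hF.comp (Measurable.prodMk ?_ (by fun_prop))
    exact hl.comp (by fun_prop : Measurable fun w : Plane × Bool × ℝ × (ℂ × (ℕ × ℝ)) =>
      (w.1, w.2.1, w.2.2.1))
  have hH : Measurable fun t => ∫⁻ r, F t r ∂(stdComplexNormal.prod p.loadGainLaw) :=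
    hF.lintegral_prod_right'
  have hHl : Measurable fun z : Plane × Bool × ℝ =>
      ∫⁻ r, F (p.linkLoss z.1 z.2.1 z.2.2) r ∂(stdComplexNormal.prod p.loadGainLaw) := hH.comp hl
  unfold markLaw
  rw [lintegral_prod _ hm.aemeasurable, lintegral_smul_measure, smul_eq_mul, lossIntensity,
    lintegral_map hH hl, lintegral_prod _ hHl.aemeasurable]
  congr 1
  refine lintegral_congr fun y => ?_
  have hy : Measurable fun w : Bool × ℝ × (ℂ × (ℕ × ℝ)) =>
      F (p.linkLoss y w.1 w.2.1) w.2.2 := hm.comp measurable_prodMk_left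
  have hHy : Measurable fun z : Bool × ℝ =>
      ∫⁻ r, F (p.linkLoss y z.1 z.2) r ∂(stdComplexNormal.prod p.loadGainLaw) :=
    hHl.comp measurable_prodMk_left
  rw [lintegral_prod _ hy.aemeasurable,
    lintegral_prod _ hHy.aemeasurable]
  refine lintegral_congr fun b => ?_
  exact lintegral_prod _ (hy.comp measurable_prodMk_left).aemeasurable

lemma measurable_kernel (s v : ℝ) (n : ℕ) : Measurable (p.kernel s v n) := by
  unfold kernel
  split_ifs <;> fun_prop

/-- Loss of a BS, and its interference multiplied by `s`, as a function of its position and of its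
marks. -/
noncomputable def lossInterference (s : ℝ) (w : Plane × Bool × ℝ × (ℂ × (ℕ × ℝ))) : ℝ × ℝ≥0∞ :=
  (p.linkLoss w.1 w.2.1 w.2.2.1, ENNReal.ofReal s * ENNReal.ofReal (p.G * ‖w.2.2.2.1‖ ^ 2 *
    (p.linkLoss w.1 w.2.1 w.2.2.1)⁻¹ * w.2.2.2.2.2 / w.2.2.2.2.1))

lemma measurable_lossInterference (s : ℝ) : Measurable (p.lossInterference s) := by
  have hl : Measurable fun w : Plane × Bool × ℝ × (ℂ × (ℕ × ℝ)) =>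
      p.linkLoss w.1 w.2.1 w.2.2.1 :=
    p.measurable_linkLoss.comp (by fun_prop : Measurable
      fun w : Plane × Bool × ℝ × (ℂ × (ℕ × ℝ)) => (w.1, w.2.1, w.2.2.1))
  have hn : Measurable fun w : Plane × Bool × ℝ × (ℂ × (ℕ × ℝ)) => (w.2.2.2.2.1 : ℝ) :=
    (measurable_from_top (f := fun n : ℕ => (n : ℝ))).comp (by fun_prop)
  exact hl.prodMk (by fun_prop)

/-- Intensity measure of the pairs of loss and interference. -/
noncomputable def lossInterferenceIntensity (s : ℝ) : Measure (ℝ × ℝ≥0∞) :=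
  ((ENNReal.ofReal p.lamBS • (volume : Measure Plane)).prod p.markLaw).map (p.lossInterference s)

/-- At a fixed loss `t`, average over the fading to get the kernel, then over the finitely many
loads and gains. The loss is integrated last, against `M'(t) dt`. -/
lemma laplaceAbove_lossInterferenceIntensity {s l : ℝ} (hs : 0 ≤ s) (hl : 0 < l) :
    laplaceAbove (p.lossInterferenceIntensity s) l =
      nexp (ENNReal.ofReal p.lamBS * p.exponent s l) := by
  let K : ℝ → ℂ × (ℕ × ℝ) → ℝ≥0∞ := fun t r => 1 - nexp (ENNReal.ofReal s *
    ENNReal.ofReal (p.G * ‖r.1‖ ^ 2 * t⁻¹ * r.2.2 / r.2.1))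
  have hn : Measurable fun w : ℝ × ℂ × (ℕ × ℝ) => (w.2.2.1 : ℝ) :=
    (measurable_from_top (f := fun n : ℕ => (n : ℝ))).comp (by fun_prop)
  have hK : Measurable (Function.uncurry K) := by
    simp only [K, Function.uncurry_def]
    fun_prop
  let F : ℝ → ℂ × (ℕ × ℝ) → ℝ≥0∞ := fun t r => (Set.Ioi l).indicator (fun t => K t r) t
  have hF : Measurable (Function.uncurry F) := by
    have : Function.uncurry F = (Prod.fst ⁻¹' Set.Ioi l).indicator (Function.uncurry K) := by
      ext w; rfl
    rw [this]
    exact hK.indicator (measurable_fst measurableSet_Ioi)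
  have hset : MeasurableSet {w : ℝ × ℝ≥0∞ | l < w.1} :=
    measurableSet_lt measurable_const measurable_fst
  rw [laplaceAbove, lossInterferenceIntensity, ← lintegral_indicator hset,
    lintegral_map (Measurable.indicator (by fun_prop) hset) (p.measurable_lossInterference s)]
  congr 1
  have e1 : ∀ w : Plane × Bool × ℝ × (ℂ × (ℕ × ℝ)),
      Set.indicator {w : ℝ × ℝ≥0∞ | l < w.1} (fun w => 1 - nexp w.2) (p.lossInterference s w) =
        F (p.linkLoss w.1 w.2.1 w.2.2.1) w.2.2.2 := fun w => by
    simp [F, K, Set.indicator_apply, lossInterference]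
  simp_rw [e1]
  rw [p.lintegral_prod_markLaw hF]
  congr 1
  have e2 : ∀ t, ∫⁻ r, F t r ∂(stdComplexNormal.prod p.loadGainLaw) =
      (Set.Ioi l).indicator (fun t => ∫⁻ r, K t r ∂(stdComplexNormal.prod p.loadGainLaw)) t := by
    intro t
    by_cases h : t ∈ Set.Ioi l <;> simp [F, h]
  have e3 : ∀ t, 0 < t → ∫⁻ r, K t r ∂(stdComplexNormal.prod p.loadGainLaw) =
      ∑ n ∈ Finset.range (p.UM + 1), ENNReal.ofReal (p.loadPMF n) *
        ∑ k ∈ Finset.range (n + 1), ENNReal.ofReal (p.collisionProb n k) *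
        (ENNReal.ofReal p.alignProb * ENNReal.ofReal (p.kernel s (p.beamGain n k) n t) +
          ENNReal.ofReal (1 - p.alignProb) *
            ENNReal.ofReal (p.kernel s (p.rhoUE ^ 2 * p.beamGain n k) n t)) := by
    intro t ht
    have hKt : Measurable (K t) := hK.of_uncurry_left
    rw [lintegral_prod_symm _ hKt.aemeasurable, p.lintegral_loadGainLaw _ hKt.lintegral_prod_left']
    refine Finset.sum_congr rfl fun n _ => ?_
    congr 1
    refine Finset.sum_congr rfl fun k hk => ?_
    have hkn : k ≤ n := Nat.lt_succ_iff.1 (Finset.mem_range.1 hk)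
    have hv := p.beamGain_nonneg hkn
    have hv0 : n = 0 → p.beamGain n k = 0 := by
      rintro rfl
      rw [Nat.le_zero.1 hkn, beamGain_zero_zero]
    simp only [K]
    rw [p.lintegral_one_sub_nexp_fading hs ht hv hv0,
      p.lintegral_one_sub_nexp_fading hs ht (by positivity) (fun h => by rw [hv0 h, mul_zero])]
  have hKi : Measurable fun t => ∫⁻ r, K t r ∂(stdComplexNormal.prod p.loadGainLaw) :=
    hK.lintegral_prod_right'
  have hmd : Measurable fun t => ENNReal.ofReal (deriv p.M t) :=
    ENNReal.measurable_ofReal.comp (measurable_deriv _)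
  have hmk : ∀ (v : ℝ) (n : ℕ), Measurable fun t => ENNReal.ofReal (deriv p.M t * p.kernel s v n t) :=
    fun v n => ENNReal.measurable_ofReal.comp ((measurable_deriv _).mul (p.measurable_kernel s v n))
  have e4 : ∀ v n, p.lossIntegral s l v n =
      ∫⁻ t in Set.Ioi l, ENNReal.ofReal (deriv p.M t * p.kernel s v n t) := fun v n =>
    setLIntegral_congr Ioi_ae_eq_Ici.symm
  simp_rw [e2]
  rw [lintegral_indicator measurableSet_Ioi, p.restrict_lossIntensity hl,
    lintegral_withDensity_eq_lintegral_mul _ hmd hKi]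
  have e5 : ∀ t ∈ Set.Ioi l, ((fun t => ENNReal.ofReal (deriv p.M t)) *
      fun t => ∫⁻ r, K t r ∂(stdComplexNormal.prod p.loadGainLaw)) t =
      ∑ n ∈ Finset.range (p.UM + 1), ENNReal.ofReal (p.loadPMF n) *
        ∑ k ∈ Finset.range (n + 1), ENNReal.ofReal (p.collisionProb n k) *
        (ENNReal.ofReal p.alignProb *
            ENNReal.ofReal (deriv p.M t * p.kernel s (p.beamGain n k) n t) +
          ENNReal.ofReal (1 - p.alignProb) *
            ENNReal.ofReal (deriv p.M t * p.kernel s (p.rhoUE ^ 2 * p.beamGain n k) n t)) := by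
    intro t ht
    have ht0 : 0 < t := hl.trans ht
    simp only [Pi.mul_apply]
    rw [e3 t ht0, Finset.mul_sum]
    refine Finset.sum_congr rfl fun n _ => ?_
    rw [mul_left_comm, Finset.mul_sum]
    congr 1
    refine Finset.sum_congr rfl fun k _ => ?_
    rw [ENNReal.ofReal_mul (p.deriv_M_nonneg ht0), ENNReal.ofReal_mul (p.deriv_M_nonneg ht0)]
    ring
  rw [setLIntegral_congr_fun measurableSet_Ioi e5, exponent, lintegral_finsetSum _ (by fun_prop)]
  refine Finset.sum_congr rfl fun n _ => ?_
  rw [lintegral_const_mul _ (by fun_prop), lintegral_finsetSum _ (by fun_prop)]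
  congr 1
  refine Finset.sum_congr rfl fun k _ => ?_
  rw [lintegral_const_mul _ (by fun_prop), lintegral_add_left (by fun_prop),
    lintegral_const_mul _ (by fun_prop), lintegral_const_mul _ (by fun_prop), e4, e4]

/-! ### Finiteness for `αN > 2` -/

/-- LOS links lie within distance `D` and cover at most `π D²`, so only the NLOS exponent governs
growth at infinity. -/
lemma M_le {t : ℝ} (ht : 0 < t) : p.M t ≤ Real.pi * p.D ^ 2 + Real.pi *
    Real.exp (2 * p.sigmaN ^ 2 / p.alphaN ^ 2 + 2 * p.m / p.alphaN) * t ^ (2 / p.alphaN) := by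
  have hN := (integrable_lossRadius_sq (σ := p.sigmaN) (m := p.m) p.alphaN_pos ht).const_mul Real.pi
  set R := fun x => Real.pi * lossRadius p.alphaN p.sigmaN p.m t x ^ 2
  have hle : ∀ b, ∫ x, p.lossArea t b x ∂(gaussianReal 0 1) ≤
      ∫ x, (Real.pi * p.D ^ 2 + R x) ∂(gaussianReal 0 1) := by
    intro b
    refine integral_mono (p.integrable_lossArea ht b) ((integrable_const _).add hN) fun x => ?_
    have h1 : min p.D (lossRadius p.alphaL p.sigmaL p.m t x) ^ 2 ≤ p.D ^ 2 :=
      pow_le_pow_left₀ (le_min p.D_pos.le (lossRadius_pos _ _ _ _ _).le) (min_le_left _ _) 2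
    have h2 := mul_le_mul_of_nonneg_left h1 Real.pi_pos.le
    have h3 := mul_nonneg Real.pi_pos.le (sq_nonneg (min p.D (lossRadius p.alphaN p.sigmaN p.m t x)))
    have h4 := mul_nonneg Real.pi_pos.le (sq_nonneg p.D)
    unfold lossArea
    simp only [R]
    split_ifs <;> linarith
  rw [integral_add (integrable_const _) hN, integral_const, probReal_univ, one_smul,
    integral_const_mul, integral_lossRadius_sq p.alphaN_pos ht] at hle
  rw [p.M_eq ht]
  have h1 := mul_le_mul_of_nonneg_left (hle true) p.pLOS.2.1
  have h2 := mul_le_mul_of_nonneg_left (hle false) (sub_nonneg.2 p.pLOS.2.2)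
  linarith

instance : SFinite p.lossIntensity := by unfold lossIntensity; infer_instance

lemma lintegral_inv_lossIntensity_lt_top (hα : 2 < p.alphaN) {l : ℝ} (hl : 0 < l) :
    ∫⁻ t in Set.Ioi l, ENNReal.ofReal t⁻¹ ∂p.lossIntensity < ∞ := by
  -- Writing `1 / t` as the integral of `u ^ (-2)` over `u > t` and exchanging the integrals
  -- replaces the loss intensity by its distribution function, bounded by `M u`.
  have hinv : ∀ t ∈ Set.Ioi l, ENNReal.ofReal t⁻¹ =
      ∫⁻ u, (Set.Ioi t).indicator (fun u => ENNReal.ofReal (u ^ (-2 : ℝ))) u := by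
    intro t ht
    have ht0 : 0 < t := hl.trans ht
    rw [lintegral_indicator measurableSet_Ioi, ← ofReal_integral_eq_lintegral_ofReal
      (integrableOn_Ioi_rpow_of_lt (by norm_num) ht0),
      integral_Ioi_rpow_of_lt (by norm_num) ht0]
    · norm_num [Real.rpow_neg_one]
    · filter_upwards [ae_restrict_mem measurableSet_Ioi] with u hu
      exact Real.rpow_nonneg (ht0.trans hu).le _
  have hmeas : Measurable fun z : ℝ × ℝ =>
      (Set.Ioi z.1).indicator (fun u => ENNReal.ofReal (u ^ (-2 : ℝ))) z.2 := by
    have : (fun z : ℝ × ℝ => (Set.Ioi z.1).indicator (fun u => ENNReal.ofReal (u ^ (-2 : ℝ))) z.2)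
        = Set.indicator {z : ℝ × ℝ | z.1 < z.2} fun z => ENNReal.ofReal (z.2 ^ (-2 : ℝ)) := by
      ext z; simp [Set.indicator_apply]
    rw [this]
    exact Measurable.indicator (by fun_prop) (measurableSet_lt measurable_fst measurable_snd)
  rw [setLIntegral_congr_fun measurableSet_Ioi hinv,
    lintegral_lintegral_swap hmeas.aemeasurable]
  set B := Real.pi * Real.exp (2 * p.sigmaN ^ 2 / p.alphaN ^ 2 + 2 * p.m / p.alphaN)
  have hbound : ∀ u, ∫⁻ t in Set.Ioi l, (Set.Ioi t).indicator
      (fun u => ENNReal.ofReal (u ^ (-2 : ℝ))) u ∂p.lossIntensity ≤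
      (Set.Ioi l).indicator (fun u => ENNReal.ofReal
        (Real.pi * p.D ^ 2 * u ^ (-2 : ℝ) + B * u ^ (2 / p.alphaN - 2))) u := by
    intro u
    have h1 : ∀ t, (Set.Ioi t).indicator (fun u => ENNReal.ofReal (u ^ (-2 : ℝ))) u =
        (Set.Iio u).indicator (fun _ => ENNReal.ofReal (u ^ (-2 : ℝ))) t := fun t => by
      simp [Set.indicator_apply]
    simp_rw [h1]
    rw [lintegral_indicator_const measurableSet_Iio, Measure.restrict_apply measurableSet_Iio]
    rcases le_or_gt u l with hu | hu
    · have : Set.Iio u ∩ Set.Ioi l = ∅ := by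
        ext x
        simp only [Set.mem_inter_iff, Set.mem_Iio, Set.mem_Ioi, Set.mem_empty_iff_false, iff_false]
        intro h
        linarith [h.1, h.2]
      simp [this]
    · have hu0 : 0 < u := hl.trans hu
      rw [Set.indicator_of_mem (Set.mem_Ioi.2 hu)]
      have hle : p.lossIntensity (Set.Iio u ∩ Set.Ioi l) ≤ ENNReal.ofReal (p.M u) := by
        rw [← p.lossIntensity_Iic hu0]
        exact measure_mono (Set.inter_subset_left.trans Set.Iio_subset_Iic_self)
      have hpow : 0 ≤ u ^ (-2 : ℝ) := Real.rpow_nonneg hu0.le _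
      refine (mul_le_mul_right hle _).trans ?_
      rw [← ENNReal.ofReal_mul hpow]
      refine ENNReal.ofReal_le_ofReal ((mul_le_mul_of_nonneg_left (p.M_le hu0) hpow).trans_eq ?_)
      rw [show 2 / p.alphaN - 2 = 2 / p.alphaN + -2 by ring, Real.rpow_add hu0]
      ring
  refine (lintegral_mono hbound).trans_lt ?_
  rw [lintegral_indicator measurableSet_Ioi]
  -- This is where `αN > 2` enters: it makes `u ^ (2 / αN - 2)` integrable at infinity.
  have h2 : 2 / p.alphaN - 2 < -1 := by
    have : 2 / p.alphaN < 1 := (div_lt_one (by linarith)).2 hα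
    linarith
  exact (((integrableOn_Ioi_rpow_of_lt (by norm_num) hl).const_mul _).add
    ((integrableOn_Ioi_rpow_of_lt h2 hl).const_mul _)).lintegral_lt_top

lemma lossIntegral_le {s l v : ℝ} {n : ℕ} (hs : 0 ≤ s) (hl : 0 < l) (hv : 0 ≤ v)
    (hn : n = 0 → v = 0) :
    p.lossIntegral s l v n ≤ ENNReal.ofReal s * (ENNReal.ofReal (p.G * v / n) *
      ∫⁻ t in Set.Ioi l, ENNReal.ofReal t⁻¹ ∂p.lossIntensity) := by
  have hG := p.G_pos
  have hmd : Measurable fun t => ENNReal.ofReal (deriv p.M t) :=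
    ENNReal.measurable_ofReal.comp (measurable_deriv _)
  have hmi : Measurable fun t : ℝ => ENNReal.ofReal t⁻¹ := by fun_prop
  rw [lossIntegral, setLIntegral_congr Ioi_ae_eq_Ici.symm, p.restrict_lossIntensity hl,
    lintegral_withDensity_eq_lintegral_mul _ hmd hmi, ← lintegral_const_mul _ (hmd.mul hmi),
    ← lintegral_const_mul _ ((hmd.mul hmi).const_mul _)]
  refine setLIntegral_mono' measurableSet_Ioi fun t ht => ?_
  have ht0 : 0 < t := hl.trans ht
  have hd := p.deriv_M_nonneg ht0
  simp only [Pi.mul_apply]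
  rw [← ENNReal.ofReal_mul hd, ← ENNReal.ofReal_mul (by positivity), ← ENNReal.ofReal_mul hs]
  refine ENNReal.ofReal_le_ofReal ?_
  -- This is `c / (1 + c) ≤ c` with `c = s G v / (t n)`.
  have hk : p.kernel s v n t ≤ s * p.G * v / n * t⁻¹ := by
    unfold kernel
    split_ifs with h0
    · positivity
    · have hv0 : v ≠ 0 := right_ne_zero_of_mul h0
      have hs0 : s ≠ 0 := left_ne_zero_of_mul (left_ne_zero_of_mul h0)
      have hn0 : (n : ℝ) ≠ 0 := by
        intro h'; exact hv0 (hn (by exact_mod_cast h'))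
      have hn1 : (0 : ℝ) < n := lt_of_le_of_ne (Nat.cast_nonneg _) hn0.symm
      have hs1 : 0 < s := lt_of_le_of_ne hs hs0.symm
      have hv1 : 0 < v := lt_of_le_of_ne hv hv0.symm
      calc 1 / (1 + t * n / (s * p.G * v)) ≤ 1 / (t * n / (s * p.G * v)) := by
            apply one_div_le_one_div_of_le (by positivity); linarith
        _ = _ := by field_simp
  refine (mul_le_mul_of_nonneg_left hk hd).trans_eq ?_
  ring

/-- The bound is linear in `s` with `C` independent of `s`, so it gives both finiteness and the
limit `s → 0` used for the interference. -/
lemma exists_exponent_le (hα : 2 < p.alphaN) {l : ℝ} (hl : 0 < l) :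
    ∃ C < ∞, ∀ s, 0 ≤ s → p.exponent s l ≤ ENNReal.ofReal s * C := by
  set T := ∫⁻ t in Set.Ioi l, ENNReal.ofReal t⁻¹ ∂p.lossIntensity
  have hT : T < ∞ := p.lintegral_inv_lossIntensity_lt_top hα hl
  refine ⟨∑ n ∈ Finset.range (p.UM + 1), ENNReal.ofReal (p.loadPMF n) *
    ∑ k ∈ Finset.range (n + 1), ENNReal.ofReal (p.collisionProb n k) *
      (ENNReal.ofReal p.alignProb * (ENNReal.ofReal (p.G * p.beamGain n k / n) * T) +
        ENNReal.ofReal (1 - p.alignProb) *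
          (ENNReal.ofReal (p.G * (p.rhoUE ^ 2 * p.beamGain n k) / n) * T)), ?_, fun s hs => ?_⟩
  · refine ENNReal.sum_lt_top.2 fun n _ => ENNReal.mul_lt_top ENNReal.ofReal_lt_top ?_
    refine ENNReal.sum_lt_top.2 fun k _ => ENNReal.mul_lt_top ENNReal.ofReal_lt_top ?_
    have := fun a : ℝ => ENNReal.mul_lt_top (ENNReal.ofReal_lt_top (r := a)) hT
    exact ENNReal.add_lt_top.2 ⟨ENNReal.mul_lt_top ENNReal.ofReal_lt_top (this _),
      ENNReal.mul_lt_top ENNReal.ofReal_lt_top (this _)⟩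
  · rw [exponent, Finset.mul_sum]
    refine Finset.sum_le_sum fun n _ => ?_
    rw [mul_left_comm]
    gcongr ENNReal.ofReal _ * ?_
    rw [Finset.mul_sum]
    refine Finset.sum_le_sum fun k hk => ?_
    have hkn : k ≤ n := Nat.lt_succ_iff.1 (Finset.mem_range.1 hk)
    have hv := p.beamGain_nonneg hkn
    have hv0 : n = 0 → p.beamGain n k = 0 := by
      rintro rfl
      rw [Nat.le_zero.1 hkn, beamGain_zero_zero]
    rw [mul_left_comm]
    gcongr ENNReal.ofReal _ * ?_
    rw [mul_add, mul_left_comm _ (ENNReal.ofReal p.alignProb),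
      mul_left_comm _ (ENNReal.ofReal (1 - p.alignProb))]
    gcongr
    · exact p.lossIntegral_le hs hl hv hv0
    · exact p.lossIntegral_le hs hl (by positivity) fun h => by rw [hv0 h, mul_zero]

end Params

/-! ### The marked process of base stations -/

/-- The marks of a BS as a tuple. -/
abbrev MarkTuple : Type := Bool × ℝ × ℂ × (ℕ × ℝ)

lemma measurable_toTuple : Measurable Mark.toTuple := comap_measurable _

lemma Params.linkLoss_injective (p : Params) (y : Plane) (b : Bool) :
    Function.Injective (p.linkLoss y b) := by
  intro x x' h
  rw [p.linkLoss_eq, p.linkLoss_eq] at h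
  have hL := p.sigmaL_pos
  have hN := p.sigmaN_pos
  split_ifs at h
  · have := Real.exp_injective h
    exact mul_left_cancel₀ hL.ne' (by linarith)
  · have := Real.exp_injective h
    exact mul_left_cancel₀ hN.ne' (by linarith)

namespace Network
variable {Ω : Type*} [MeasurableSpace Ω] {p : Params} {P : Measure Ω} (net : Network p P)

/-- Position and marks of a BS. -/
def point (i : ℕ) (ω : Ω) : Plane × Bool × ℝ × (ℂ × (ℕ × ℝ)) :=
  (net.pos i ω, (net.mark i ω).toTuple)

lemma measurable_tuple (i : ℕ) : Measurable fun ω => (net.mark i ω).toTuple :=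
  measurable_toTuple.comp (net.measurable_mark i)

lemma measurable_point (i : ℕ) : Measurable (net.point i) :=
  (net.measurable_pos i).prodMk (net.measurable_tuple i)

lemma lossInterference_point (s : ℝ) (i : ℕ) (ω : Ω) :
    p.lossInterference s (net.point i ω) = (net.lossOf i ω, ENNReal.ofReal s *
      ENNReal.ofReal (p.G * ‖(net.mark i ω).fading‖ ^ 2 * (net.lossOf i ω)⁻¹ *
      (net.mark i ω).gain / (net.mark i ω).load)) := by
  rw [lossOf, p.loss_eq_linkLoss]
  rfl

lemma measurable_lossOf (i : ℕ) : Measurable (net.lossOf i) := by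
  have := ((p.measurable_lossInterference 0).comp (net.measurable_point i)).fst
  simpa only [Function.comp_def, lossInterference_point] using this

lemma measurable_servingLoss : Measurable net.servingLoss := by
  have : Measurable fun z : ℕ × Ω => net.lossOf z.1 z.2 :=
    measurable_from_prod_countable_right net.measurable_lossOf
  have h := this.comp (net.measurable_serving.prodMk measurable_id)
  simp only [Function.comp_def, id] at h
  exact h

lemma measurable_interference : Measurable net.interference := by
  refine Measurable.tsum fun i => Measurable.ite ?_ measurable_const ?_
  · exact measurableSet_eq_fun measurable_const net.measurable_serving
  · have := ((p.measurable_lossInterference 1).comp (net.measurable_point i)).snd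
    simpa only [Function.comp_def, lossInterference_point, ENNReal.ofReal_one, one_mul] using this

lemma servingLoss_pos (ω : Ω) : 0 < net.servingLoss ω := by
  rw [servingLoss, lossOf, p.loss_eq_linkLoss]
  exact p.linkLoss_pos _ _ _

lemma ae_servingLoss_map_pos : ∀ᵐ l ∂(P.map net.servingLoss), 0 < l := by
  rw [ae_map_iff net.measurable_servingLoss.aemeasurable measurableSet_Ioi]
  exact ae_of_all _ net.servingLoss_pos

/-! ### Almost sure uniqueness of the minimal loss -/

/-- For each value of the LOS indicator at most one shadowing value gives loss `c`, and the Gaussian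
law has no atoms. -/
lemma measure_linkLoss_eq (i : ℕ) (y : Plane) (c : ℝ) :
    P {ω | p.linkLoss y (net.mark i ω).clear (net.mark i ω).shadow = c} = 0 := by
  have hm : MeasurableSet {k : Bool × ℝ × (ℂ × (ℕ × ℝ)) | p.linkLoss y k.1 k.2.1 = c} := by
    refine measurableSet_eq_fun ?_ measurable_const
    exact p.measurable_linkLoss.comp (g := fun z : Plane × Bool × ℝ => p.linkLoss z.1 z.2.1 z.2.2)
      (f := fun k : Bool × ℝ × (ℂ × (ℕ × ℝ)) => (y, k.1, k.2.1)) (by fun_prop)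
  have h : P {ω | p.linkLoss y (net.mark i ω).clear (net.mark i ω).shadow = c} =
      p.markLaw {k | p.linkLoss y k.1 k.2.1 = c} := by
    rw [← net.mark_law i, Measure.map_apply (net.measurable_tuple i) hm]
    rfl
  rw [h, Params.markLaw, Measure.measure_prod_null hm]
  refine ae_of_all _ fun b => ?_
  have hs : Prod.mk b ⁻¹' {k : Bool × ℝ × (ℂ × (ℕ × ℝ)) | p.linkLoss y k.1 k.2.1 = c} =
      {x | p.linkLoss y b x = c} ×ˢ Set.univ := by
    ext k; simp
  have hsub : {x | p.linkLoss y b x = c}.Subsingleton := fun x hx x' hx' =>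
    p.linkLoss_injective y b (hx.trans hx'.symm)
  have := nullSingletonClass_gaussianReal (μ := 0) (v := 1) one_ne_zero
  simp only [hs, Measure.prod_prod, hsub.measure_zero, zero_mul, Pi.zero_apply]

variable [IsProbabilityMeasure P]

lemma hasPoissonLaplace (s : ℝ) :
    HasPoissonLaplace (fun i ω => p.lossInterference s (net.point i ω))
      (p.lossInterferenceIntensity s) P := by
  have : SigmaFinite (ENNReal.ofReal p.lamBS • (volume : Measure Plane)) := by
    change SigmaFinite (p.lamBS.toNNReal • (volume : Measure Plane))
    infer_instance
  exact ((net.isPoisson.hasPoissonLaplace net.measurable_pos).prodMk net.measurable_pos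
    net.measurable_tuple net.mark_law (net.mark_indep.comp _ fun _ => measurable_toTuple)
    (net.mark_indep_pos.comp (φ := fun k i => (k i).toTuple) (ψ := id)
      (measurable_pi_lambda _ fun i => measurable_toTuple.comp (measurable_pi_apply i))
      measurable_id)).map (p.measurable_lossInterference s)

/-- Freeze both positions and the mark of `j`: the independent shadowing of `i` hits the required
loss with probability zero. Nothing about the joint law of the positions is needed. -/
lemma ae_lossOf_ne {i j : ℕ} (hij : i ≠ j) : ∀ᵐ ω ∂P, net.lossOf i ω ≠ net.lossOf j ω := by
  let A : Set ((MarkTuple × MarkTuple) × (Plane × Plane)) :=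
    {z | p.linkLoss z.2.1 z.1.1.1 z.1.1.2.1 = p.linkLoss z.2.2 z.1.2.1 z.1.2.2.1}
  have hA : MeasurableSet A := by
    refine measurableSet_eq_fun ?_ ?_
    · exact p.measurable_linkLoss.comp
        (g := fun z : Plane × Bool × ℝ => p.linkLoss z.1 z.2.1 z.2.2)
        (f := fun z : (MarkTuple × MarkTuple) × (Plane × Plane) => (z.2.1, z.1.1.1, z.1.1.2.1)) (by fun_prop)
    · exact p.measurable_linkLoss.comp
        (g := fun z : Plane × Bool × ℝ => p.linkLoss z.1 z.2.1 z.2.2)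
        (f := fun z : (MarkTuple × MarkTuple) × (Plane × Plane) => (z.2.2, z.1.2.1, z.1.2.2.1)) (by fun_prop)
  have hind : IndepFun (fun ω => ((net.mark i ω).toTuple, (net.mark j ω).toTuple))
      (fun ω => (net.pos i ω, net.pos j ω)) P :=
    net.mark_indep_pos.comp (φ := fun k => ((k i).toTuple, (k j).toTuple))
      (ψ := fun y => (y i, y j))
      ((measurable_toTuple.comp (measurable_pi_apply i)).prodMk
        (measurable_toTuple.comp (measurable_pi_apply j)))
      ((measurable_pi_apply i).prodMk (measurable_pi_apply j))
  have hind' : IndepFun (fun ω => (net.mark i ω).toTuple) (fun ω => (net.mark j ω).toTuple) P :=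
    (net.mark_indep.indepFun hij).comp measurable_toTuple measurable_toTuple
  have hset : {ω | ¬ net.lossOf i ω ≠ net.lossOf j ω} =
      (fun ω => (((net.mark i ω).toTuple, (net.mark j ω).toTuple), (net.pos i ω, net.pos j ω)))
        ⁻¹' A := by
    ext ω
    simp only [ne_eq, not_not, lossOf, p.loss_eq_linkLoss]
    rfl
  have hmeas : Measurable fun ω => (((net.mark i ω).toTuple, (net.mark j ω).toTuple),
      (net.pos i ω, net.pos j ω)) :=
    ((net.measurable_tuple i).prodMk (net.measurable_tuple j)).prodMk
      ((net.measurable_pos i).prodMk (net.measurable_pos j))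
  have h1 := lintegral_indepFun_eq_lintegral_lintegral
    (f := fun k y => A.indicator (fun _ => (1 : ℝ≥0∞)) (k, y))
    ((net.measurable_tuple i).prodMk (net.measurable_tuple j))
    ((net.measurable_pos i).prodMk (net.measurable_pos j)) hind (measurable_const.indicator hA)
  have h2 : ∀ y : Plane × Plane, ∫⁻ ω, A.indicator (fun _ => (1 : ℝ≥0∞))
      (((net.mark i ω).toTuple, (net.mark j ω).toTuple), y) ∂P = 0 := by
    intro y
    rw [lintegral_indepFun_eq_lintegral_lintegral
      (f := fun k k' => A.indicator (fun _ => (1 : ℝ≥0∞)) ((k, k'), y))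
      (net.measurable_tuple i) (net.measurable_tuple j) hind'
      ((measurable_const.indicator hA).comp measurable_prodMk_right)]
    refine (lintegral_congr fun ω => ?_).trans lintegral_zero
    have hA' : MeasurableSet {ω' | (((net.mark i ω').toTuple, (net.mark j ω).toTuple), y) ∈ A} :=
      (((net.measurable_tuple i).prodMk measurable_const).prodMk measurable_const) hA
    have : ∀ ω', A.indicator (fun _ => (1 : ℝ≥0∞)) (((net.mark i ω').toTuple, (net.mark j ω).toTuple), y)
        = {ω' | (((net.mark i ω').toTuple, (net.mark j ω).toTuple), y) ∈ A}.indicator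
          (1 : Ω → ℝ≥0∞) ω' :=
      fun ω' => rfl
    simp_rw [this]
    rw [lintegral_indicator_one hA']
    exact net.measure_linkLoss_eq i y.1
      (p.linkLoss y.2 (net.mark j ω).clear (net.mark j ω).shadow)
  rw [ae_iff, hset, ← lintegral_indicator_one (hmeas hA)]
  refine h1.trans ?_
  simp_rw [h2]
  exact lintegral_zero

lemma ae_servingLoss_lt : ∀ᵐ ω ∂P, ∀ i, i ≠ net.serving ω → net.servingLoss ω < net.lossOf i ω := by
  have h : ∀ᵐ ω ∂P, ∀ i j, i ≠ j → net.lossOf i ω ≠ net.lossOf j ω := by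
    refine ae_all_iff.2 fun i => ae_all_iff.2 fun j => ?_
    by_cases hij : i = j
    · exact ae_of_all _ fun ω h => absurd hij h
    · filter_upwards [net.ae_lossOf_ne hij] with ω hω _ using hω
  filter_upwards [h, net.serving_min] with ω h1 h2 i hi
  exact lt_of_le_of_ne (h2 i) (h1 _ _ hi).symm

/-- Laplace transform of the interference on events determined by the loss of the serving link. -/
lemma setLIntegral_nexp_interference {s : ℝ} {B : Set ℝ} (hB : MeasurableSet B) :
    ∫⁻ ω in {ω | net.servingLoss ω ∈ B}, nexp (ENNReal.ofReal s * net.interference ω) ∂P =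
      ∫⁻ l in B, laplaceAbove (p.lossInterferenceIntensity s) l ∂(P.map net.servingLoss) := by
  have hfst : ∀ i ω, (p.lossInterference s (net.point i ω)).1 = net.lossOf i ω := fun i ω => by
    rw [lossInterference_point]
  have h := (net.hasPoissonLaplace s).setLIntegral_nexp_sum_ne_min (S := net.serving)
    (fun i => (p.measurable_lossInterference s).comp (net.measurable_point i))
    (by simp only [hfst]; exact net.measurable_servingLoss)
    (by simp only [hfst]; exact net.ae_servingLoss_lt) hB
  simp only [hfst] at h
  refine Eq.trans (lintegral_congr fun ω => ?_) h
  rw [interference, ← ENNReal.tsum_mul_left]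
  congr 1
  refine tsum_congr fun i => ?_
  rw [lossInterference_point]
  split_ifs <;> simp

/-- Both sides have the same integral over every Borel set of serving losses, by disintegration of
the joint law and `setLIntegral_nexp_interference`. -/
lemma ae_lintegral_condDistrib {s : ℝ} :
    ∀ᵐ l ∂(P.map net.servingLoss),
      ∫⁻ I, nexp (ENNReal.ofReal s * I) ∂(condDistrib net.interference net.servingLoss P l) =
        laplaceAbove (p.lossInterferenceIntensity s) l := by
  have hn : Measurable fun I : ℝ≥0∞ => nexp (ENNReal.ofReal s * I) := by fun_prop
  have hprob : IsProbabilityMeasure (P.map net.servingLoss) :=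
    Measure.isProbabilityMeasure_map net.measurable_servingLoss.aemeasurable
  refine ae_eq_of_forall_setLIntegral_eq_of_sigmaFinite hn.lintegral_kernel
    (measurable_laplaceAbove _) fun B hB _ => ?_
  rw [← net.setLIntegral_nexp_interference hB]
  have h1 := Measure.setLIntegral_compProd (μ := P.map net.servingLoss)
    (κ := condDistrib net.interference net.servingLoss P)
    (f := fun z => nexp (ENNReal.ofReal s * z.2)) (by fun_prop) hB MeasurableSet.univ
  simp only [Measure.restrict_univ] at h1
  rw [← h1, compProd_map_condDistrib net.measurable_interference.aemeasurable,
    setLIntegral_map (hB.prod MeasurableSet.univ) (by fun_prop)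
      (net.measurable_servingLoss.prodMk net.measurable_interference)]
  congr 2
  ext ω
  simp

lemma condLaplace_eq {s l : ℝ} {x : ℝ≥0∞} (h : ∫⁻ I, nexp (ENNReal.ofReal s * I)
      ∂(condDistrib net.interference net.servingLoss P l) = nexp x) :
    net.condLaplace s l = expNeg x := by
  have hm : Measurable expNeg := by
    simpa only [Function.comp_def, toReal_nexp] using
      ENNReal.measurable_toReal.comp measurable_nexp
  rw [condLaplace, integral_eq_lintegral_of_nonneg_ae (ae_of_all _ fun I => expNeg_nonneg _)
    (hm.comp (measurable_const_mul _)).aestronglyMeasurable]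
  simp_rw [ofReal_expNeg]
  rw [h, toReal_nexp]

/-- For `s > 0` the variable `exp (-s I)` vanishes where `I = ∞`, so its mean is at most `P (I <
∞)`. Along `s = 1 / (k + 1)` the exponent tends to `0`, so these means tend to `1`. -/
lemma ae_interference_lt_top (hα : 2 < p.alphaN) : ∀ᵐ ω ∂P, net.interference ω < ∞ := by
  have hprob : IsProbabilityMeasure (P.map net.servingLoss) :=
    Measure.isProbabilityMeasure_map net.measurable_servingLoss.aemeasurable
  have hmf : MeasurableSet {ω | net.interference ω < ∞} :=
    measurableSet_lt net.measurable_interference measurable_const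
  let s : ℕ → ℝ := fun k => 1 / ((k : ℝ) + 1)
  have hs : ∀ k, 0 < s k := fun k => by positivity
  have hs0 : Tendsto (fun k => ENNReal.ofReal (s k)) atTop (𝓝 0) := by
    simpa [s] using ENNReal.tendsto_ofReal tendsto_one_div_add_atTop_nhds_zero_nat
  have hlim : Tendsto (fun k => ∫⁻ l, laplaceAbove (p.lossInterferenceIntensity (s k)) l
      ∂(P.map net.servingLoss)) atTop (𝓝 (∫⁻ _, 1 ∂(P.map net.servingLoss))) := by
    refine tendsto_lintegral_of_dominated_convergence (fun _ => 1)
      (fun k => measurable_laplaceAbove _) (fun k => ae_of_all _ fun l => nexp_le_one _)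
      (by simp) ?_
    filter_upwards [net.ae_servingLoss_map_pos] with l hl
    obtain ⟨C, hC, hle⟩ := p.exists_exponent_le hα hl
    have h1 : Tendsto (fun k => ENNReal.ofReal p.lamBS * p.exponent (s k) l) atTop (𝓝 0) := by
      have h2 : Tendsto (fun k => ENNReal.ofReal p.lamBS * (ENNReal.ofReal (s k) * C)) atTop
          (𝓝 (ENNReal.ofReal p.lamBS * (0 * C))) :=
        ENNReal.Tendsto.const_mul (ENNReal.Tendsto.mul_const hs0 (Or.inr hC.ne))
          (Or.inr ENNReal.ofReal_ne_top)
      rw [zero_mul, mul_zero] at h2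
      exact tendsto_of_tendsto_of_tendsto_of_le_of_le tendsto_const_nhds h2 (fun k => zero_le)
        fun k => by gcongr; exact hle _ (hs k).le
    have h3 := (continuous_nexp.tendsto 0).comp h1
    rw [nexp_zero] at h3
    exact h3.congr fun k => (p.laplaceAbove_lossInterferenceIntensity (hs k).le hl).symm
  have hle : ∀ k, ∫⁻ l, laplaceAbove (p.lossInterferenceIntensity (s k)) l
      ∂(P.map net.servingLoss) ≤ P {ω | net.interference ω < ∞} := by
    intro k
    have h := net.setLIntegral_nexp_interference (s := s k) MeasurableSet.univ
    simp only [Set.mem_univ, Measure.restrict_univ] at h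
    rw [← h, ← lintegral_indicator_one hmf]
    refine (setLIntegral_le_lintegral _ _).trans (lintegral_mono fun ω => ?_)
    by_cases hω : net.interference ω < ∞
    · rw [Set.indicator_of_mem (show ω ∈ {ω | net.interference ω < ∞} from hω)]
      exact nexp_le_one _
    · have h0 : ENNReal.ofReal (s k) ≠ 0 := (ENNReal.ofReal_pos.2 (hs k)).ne'
      rw [not_lt_top_iff.1 hω, ENNReal.mul_top h0, nexp_top]
      exact zero_le
  have h1 : P {ω | net.interference ω < ∞} = 1 := by
    refine le_antisymm prob_le_one ?_
    have := le_of_tendsto' hlim hle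
    simpa using this
  exact (prob_compl_eq_zero_iff hmf).2 h1

end Network

end MmWave

theorem lemma6 {Ω : Type*} [MeasurableSpace Ω] (P : Measure Ω) [IsProbabilityMeasure P]
    (p : MmWave.Params) (net : MmWave.Network p P) (s : ℝ) (hs : 0 ≤ s) :
    -- `M` is differentiable and nondecreasing on `(0, ∞)`
    (∀ t : ℝ, 0 < t → DifferentiableAt ℝ p.M t ∧ 0 ≤ deriv p.M t) ∧
    -- the conditional Laplace transform in closed form
    (∀ᵐ l ∂(P.map net.servingLoss),
      0 < l ∧ net.condLaplace s l = MmWave.expNeg (ENNReal.ofReal p.lamBS * p.exponent s l)) ∧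
    -- all quantities are finite if the NLOS path loss exponent exceeds 2
    (2 < p.alphaN → (∀ᵐ ω ∂P, net.interference ω < ∞) ∧
      ∀ l : ℝ, 0 < l → p.exponent s l < ∞) := by
  refine ⟨fun t ht => ⟨p.differentiableAt_M ht, p.deriv_M_nonneg ht⟩, ?_, fun hα =>
    ⟨net.ae_interference_lt_top hα, fun l hl => ?_⟩⟩
  · filter_upwards [net.ae_servingLoss_map_pos, net.ae_lintegral_condDistrib (s := s)] with l hl h
    rw [p.laplaceAbove_lossInterferenceIntensity hs hl] at h
    exact ⟨hl, net.condLaplace_eq h⟩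
  · obtain ⟨C, hC, hle⟩ := p.exists_exponent_le hα hl
    exact (hle s hs).trans_lt (ENNReal.mul_lt_top ENNReal.ofReal_lt_top hC)
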